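/- Let $n,k\in\mathbb N$ and $0<\rho<1$. Let $\mathcal M_{k,\rho}$ be the set of matrices $M\in[0,\rho]^{n\times n}$ with $M_{ii}=0$ for all $i$ for which there are labels $z\in[k]^n$ and a symmetric matrix $Q\in[0,\rho]^{k\times k}$ such that $M_{ij}=M_{ji}=Q_{z_iz_j}$ for all $i\neq j$. Given $M\in\mathcal M_{k,\rho}$, one observes the symmetric adjacency matrix $A\in\{0,1\}^{n\times n}$ of a random graph: $A_{ii}=0$, and $A_{ij}=A_{ji}\sim\mathrm{Bernoulli}(M_{ij})$ independently over $1\le i<j\le n$. For $D\in\mathbb N$ let $\mathbb R[A]^{n\times n}_{\le D}$ be the set of estimators $\widehat M$ each of whose entries $\widehat M_{ij}$ is a real polynomial of degree at most $D$ in the entries of $A$, and let $\ell(\widehat M,M)=\binom n2^{-1}\sum_{1\le i<j\le n}(\widehat M_{ij}-M_{ij})^2$. For every $c\in(0,1)$ there exists a constant $c'>0$, depending only on $c$ (and not on $n,k,\rho,D$), such that, whenever $2\le k\le\sqrt n$, $0<\rho<1$, $\rho\ge ck^2/n$ and $D\ge1$, $$\inf_{\widehat M\in\mathbb R[A]^{n\times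 n}_{\le D}}\ \sup_{M\in\mathcal M_{k,\rho}}\ \mathbb E\big(\ell(\widehat M,M)\big)\ \ge\ \frac{c'\rho k}{nD^4}.$$ -/

import Mathlib

/-- The unordered pairs of distinct vertices of `[n]`, listed as `(i, j)` with `i < j`. -/
abbrev VertexPair (n : ℕ) : Type := {e : Fin n × Fin n // e.1 < e.2}

/-- The sparse stochastic block model class: matrices `M` with entries in `[0, ρ]` and zero
diagonal, whose off-diagonal entries are `M i j = M j i = Q (z i) (z j)` for a labelling
`z : [n] → [k]` and a symmetric matrix `Q` with entries in `[0, ρ]`. -/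
def sparseSBM (n k : ℕ) (ρ : ℝ) : Set (Matrix (Fin n) (Fin n) ℝ) :=
  {M | (∀ i j, M i j ∈ Set.Icc 0 ρ) ∧ (∀ i, M i i = 0) ∧
    ∃ (z : Fin n → Fin k) (Q : Matrix (Fin k) (Fin k) ℝ),
      Q.IsSymm ∧ (∀ a b, Q a b ∈ Set.Icc 0 ρ) ∧
      ∀ i j, i ≠ j → M i j = Q (z i) (z j) ∧ M j i = Q (z i) (z j)}

/-- The adjacency matrix of the simple graph on `[n]` whose edges are the pairs `e` with
`a e = true`: symmetric, with entries in `{0, 1}` and zero diagonal. -/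
def adjacency {n : ℕ} (a : VertexPair n → Bool) : Matrix (Fin n) (Fin n) ℝ := fun i j =>
  if h : i < j then (if a ⟨(i, j), h⟩ then 1 else 0)
  else if h : j < i then (if a ⟨(j, i), h⟩ then 1 else 0)
  else 0

/-- The probability of the graph `a` when the edge indicators, over the pairs `i < j`, are
independent Bernoulli variables with parameters `M i j`. -/
def graphProb {n : ℕ} (M : Matrix (Fin n) (Fin n) ℝ) (a : VertexPair n → Bool) : ℝ :=
  ∏ e : VertexPair n, if a e then M e.1.1 e.1.2 else 1 - M e.1.1 e.1.2

/-- The expectation `𝔼 (F A)`, where `A` is the adjacency matrix of the random graph with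
connection probabilities `M`; the sample space is finite. -/
def expectGraph {n : ℕ} (M : Matrix (Fin n) (Fin n) ℝ)
    (F : Matrix (Fin n) (Fin n) ℝ → ℝ) : ℝ :=
  ∑ a : VertexPair n → Bool, graphProb M a * F (adjacency a)

/-- The empirical loss `(n choose 2)⁻¹ * ∑_{i < j} (M' i j - M i j) ^ 2`. -/
noncomputable def loss {n : ℕ} (M' M : Matrix (Fin n) (Fin n) ℝ) : ℝ :=
  (1 / (n.choose 2 : ℝ)) * ∑ e : VertexPair n, (M' e.1.1 e.1.2 - M e.1.1 e.1.2) ^ 2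

/-- The polynomial estimators of degree at most `D`: every entry is a real polynomial of total
degree at most `D` in the entries of the adjacency matrix. -/
def lowDegreeEstimators (n D : ℕ) :
    Set (Matrix (Fin n) (Fin n) (MvPolynomial (Fin n × Fin n) ℝ)) :=
  {P | ∀ i j, (P i j).totalDegree ≤ D}

/-- The value of a polynomial estimator at the observed matrix `A`. -/
noncomputable def evalEstimator {n : ℕ}
    (P : Matrix (Fin n) (Fin n) (MvPolynomial (Fin n × Fin n) ℝ))
    (A : Matrix (Fin n) (Fin n) ℝ) : Matrix (Fin n) (Fin n) ℝ :=
  fun i j => MvPolynomial.eval (fun e => A e.1 e.2) (P i j)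

/-- The risk `𝔼 (ℓ (M̂, M))` of the estimator `P` at the connection probability matrix `M`. -/
noncomputable def risk {n : ℕ}
    (P : Matrix (Fin n) (Fin n) (MvPolynomial (Fin n × Fin n) ℝ))
    (M : Matrix (Fin n) (Fin n) ℝ) : ℝ :=
  expectGraph M (fun A => loss (evalEstimator P A) M)

/-! The supremum over the class dominates the average over a random matrix with entries `ρ / 2 + s *
X_ij`. Each vertex draws a uniform label in `ZMod K` and an independent uniform sign; `X_ij` is the
product of the two signs if the labels agree and `0` otherwise. A label with a sign is one of `2 * K
≤ k` block names. Since `𝔼 X_p ^ 2 ≥ 1 / K`, it suffices that polynomials of degree at most `D`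
explain at most half of this second moment, for each pair `p`.

This is a duality argument (`le_jointExp_sub_sq`). If `U` satisfies `𝔼 (g U) = 𝔼 (g X_p)` for every
low-degree `g`, then `𝔼 (g - s X_p)² = 𝔼 (g - s U)² + s² (𝔼 X_p² - 𝔼 U²)`. Here `U` may depend on
the hidden labels and signs, so it is built from scores centred at the true edge probabilities.
Conditional orthogonality of the scores then diagonalises `𝔼 U²`, and matching the correlations
becomes a triangular system for the coefficients, solved by `dualCoeff`.

The coefficient of a graph `C` is at most `(4 D) ^ |C|` times the probability that labels agree
along `C` (`abs_dualCoeff_le`). It vanishes unless `C` joins the endpoints of `p` and has no other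
component with an edge (`dualCoeff_signal_eq_zero`). Such a graph on `v + 2` vertices has at least
`v + 1` edges and agreement probability at most `K ^ (-(v + 1))`, and only `v` of its vertices are
free. With `s² / ρ` a small multiple of `K² / (n D⁴)` and `K² ≤ n`, the sum over graphs gives `𝔼 U²
≤ 1 / (2 n) ≤ 1 / (2 K)` (`sum_sq_mul_pow_le`). The remaining risk `s² / (2 K)` has order `c ρ k /
(n D⁴)`. The condition `ρ ≥ c k² / n` ensures `s ≤ ρ / 4`, so the edge probabilities stay comparable
to `ρ`. -/

/-! ### The triangular system: vanishing and growth of its solution. -/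

section DualCoefficients

variable {E : Type*} [DecidableEq E]

/-- The coefficients `w` solving the triangular system
`∑ α ⊆ C, w α * mom (C \ α) = target C` when `mom ∅ = 1`. -/
noncomputable def dualCoeff (mom target : Finset E → ℝ) : Finset E → ℝ :=
  Finset.strongInduction fun C ih =>
    target C - ∑ α ∈ C.ssubsets.attach, ih α.1 (Finset.mem_ssubsets.1 α.2) * mom (C \ α.1)

theorem dualCoeff_eq (mom target : Finset E → ℝ) (C : Finset E) :
    dualCoeff mom target C =
      target C - ∑ α ∈ C.ssubsets, dualCoeff mom target α * mom (C \ α) := by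
  rw [dualCoeff, Finset.strongInduction_eq,
    Finset.sum_attach C.ssubsets (fun α => Finset.strongInduction (fun C ih =>
      target C - ∑ α ∈ C.ssubsets.attach, ih α.1 (Finset.mem_ssubsets.1 α.2) * mom (C \ α.1)) α
        * mom (C \ α))]

theorem powerset_eq_insert_ssubsets (C : Finset E) : C.powerset = insert C C.ssubsets := by
  rw [Finset.ssubsets, Finset.insert_erase (Finset.mem_powerset_self C)]

theorem sum_dualCoeff_mul {mom target : Finset E → ℝ} (h1 : mom ∅ = 1) (C : Finset E) :
    ∑ α ∈ C.powerset, dualCoeff mom target α * mom (C \ α) = target C := by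
  rw [powerset_eq_insert_ssubsets, Finset.sum_insert (by simp [Finset.mem_ssubsets]),
    Finset.sdiff_self, h1, mul_one]
  linarith [dualCoeff_eq mom target C]

theorem dualCoeff_eq_zero_of_target {mom target : Finset E → ℝ} (P : Finset E → Prop)
    (hmono : ∀ α C, α ⊆ C → P C → P α) (h0 : ∀ C, P C → target C = 0) (C : Finset E) (hC : P C) :
    dualCoeff mom target C = 0 := by
  induction C using Finset.strongInduction with
  | H C ih =>
    rw [dualCoeff_eq, h0 C hC, Finset.sum_eq_zero, sub_zero]
    intro α hα
    rw [Finset.mem_ssubsets] at hα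
    rw [ih α hα (hmono α C hα.subset hC), zero_mul]

/-- A factor independent of the target carries no coefficient. By induction only the subsets of
`C.filter p` survive in the recursion, and their sum is the equation for `C.filter p` times the
moment of the rest, which already equals `target C`. -/
theorem dualCoeff_eq_zero_of_split {mom target : Finset E → ℝ} (h1 : mom ∅ = 1)
    (P : Finset E → Prop) (hmono : ∀ α C, α ⊆ C → P C → P α) (p : E → Prop) [DecidablePred p]
    (hmom : ∀ C, P C → mom C = mom (C.filter p) * mom (C.filter fun e => ¬ p e))
    (htarget : ∀ C, P C → target C = target (C.filter p) * mom (C.filter fun e => ¬ p e))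
    (C : Finset E) (hC : P C) (hne : ∃ e ∈ C, ¬ p e) :
    dualCoeff mom target C = 0 := by
  induction C using Finset.strongInduction with
  | H C ih =>
    have hss : (C.filter p).powerset ⊆ C.ssubsets := by
      intro α hα
      rw [Finset.mem_powerset] at hα
      rw [Finset.mem_ssubsets]
      refine ⟨hα.trans (Finset.filter_subset _ _), fun h => ?_⟩
      obtain ⟨e, he, hpe⟩ := hne
      exact hpe (Finset.mem_filter.1 (hα (h he))).2
    rw [dualCoeff_eq, ← Finset.sum_subset hss, htarget C hC, ← sum_dualCoeff_mul (target := target) h1 (C.filter p),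
      Finset.sum_mul, sub_eq_zero]
    · refine Finset.sum_congr rfl fun α hα => ?_
      rw [Finset.mem_powerset] at hα
      rw [hmom (C \ α) (hmono _ _ Finset.sdiff_subset hC), mul_assoc]
      congr 3
      · ext e
        simp only [Finset.mem_filter, Finset.mem_sdiff]
        tauto
      · ext e
        simp only [Finset.mem_filter, Finset.mem_sdiff]
        constructor
        · rintro ⟨h1, h2⟩
          exact ⟨⟨h1, fun h => h2 (Finset.mem_filter.1 (hα h)).2⟩, h2⟩
        · tauto
    · intro α hα hα'
      rw [Finset.mem_ssubsets] at hα
      rw [ih α hα (hmono _ _ hα.subset hC), zero_mul]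
      by_contra! h
      exact hα' (Finset.mem_powerset.2 fun e he => Finset.mem_filter.2 ⟨hα.subset he, h e he⟩)

theorem add_one_pow_le_mul_pow {x : ℝ} (hx : 0 < x) (m : ℕ) (hm : 2 * (m : ℝ) ≤ x) :
    (x + 1) ^ m ≤ (1 + 2 * m / x) * x ^ m := by
  induction m with
  | zero => simp
  | succ m ih =>
    push_cast at hm ⊢
    have h := ih (by linarith)
    calc (x + 1) ^ (m + 1) = (x + 1) ^ m * (x + 1) := pow_succ _ _
      _ ≤ (1 + 2 * m / x) * x ^ m * (x + 1) := by gcongr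
      _ = (1 + 2 * m / x + 1 / x + 2 * m / x * (1 / x)) * x ^ (m + 1) := by
        field_simp
        ring
      _ ≤ (1 + 2 * (m + 1) / x) * x ^ (m + 1) := by
        refine mul_le_mul_of_nonneg_right ?_ (by positivity)
        have h2 : 2 * m / x ≤ 1 := (div_le_one hx).2 (by linarith)
        have h3 : 2 * m / x * (1 / x) ≤ 1 * (1 / x) := by gcongr
        have h4 : 2 * ((m : ℝ) + 1) / x = 2 * m / x + 1 / x + 1 * (1 / x) := by ring
        linarith

/-- This closes the induction for `abs_dualCoeff_le`. The binomial theorem turns the sum into `(4d +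
1) ^ |C| - (4d) ^ |C|`, which is at most half of `(4d) ^ |C|` because `|C| ≤ d`; this is why the
base is `4d`. -/
theorem one_add_sum_ssubsets_pow_le {d : ℕ} (C : Finset E) (hC : C.card ≤ d) :
    1 + ∑ α ∈ C.ssubsets, (4 * (d : ℝ)) ^ α.card ≤ (4 * (d : ℝ)) ^ C.card := by
  have h := Finset.sum_pow_mul_eq_add_pow (4 * (d : ℝ)) 1 C
  simp only [one_pow, mul_one] at h
  rw [powerset_eq_insert_ssubsets, Finset.sum_insert (by simp [Finset.mem_ssubsets])] at h
  rcases Nat.eq_zero_or_pos C.card with h0 | h0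
  · have h1 : C = ∅ := Finset.card_eq_zero.1 h0
    subst h1
    simp [Finset.ssubsets]
  · have hd : (1 : ℝ) ≤ d := by exact_mod_cast h0.trans_le hC
    have hCd : (C.card : ℝ) ≤ d := by exact_mod_cast hC
    have h2 := add_one_pow_le_mul_pow (x := 4 * (d : ℝ)) (by linarith) C.card (by linarith)
    have h3 : 2 * (C.card : ℝ) / (4 * d) ≤ 1 / 2 := by
      rw [div_le_iff₀ (by linarith)]
      linarith
    have h4 : (4 : ℝ) ≤ (4 * d) ^ C.card :=
      calc (4 : ℝ) ≤ 4 * d := by linarith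
        _ = (4 * d) ^ 1 := (pow_one _).symm
        _ ≤ (4 * d) ^ C.card := pow_le_pow_right₀ (by linarith) h0
    have h5 : (1 + 2 * (C.card : ℝ) / (4 * d)) * (4 * (d : ℝ)) ^ C.card ≤
        (3 / 2) * (4 * (d : ℝ)) ^ C.card := by
      gcongr
      linarith
    linarith

/-- Supermultiplicativity of `π` lets every term of the recursion be charged to the same `π C`,
leaving only the combinatorial sum over proper subsets. -/
theorem abs_dualCoeff_le {mom target π : Finset E → ℝ} {d : ℕ} (hπ : ∀ C, 0 ≤ π C)
    (hmom : ∀ C, |mom C| ≤ π C) (htarget : ∀ C, |target C| ≤ π C)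
    (hmul : ∀ α C, α ⊆ C → π α * π (C \ α) ≤ π C) (C : Finset E) (hC : C.card ≤ d) :
    |dualCoeff mom target C| ≤ (4 * (d : ℝ)) ^ C.card * π C := by
  induction C using Finset.strongInduction with
  | H C ih =>
    rw [dualCoeff_eq]
    calc |target C - ∑ α ∈ C.ssubsets, dualCoeff mom target α * mom (C \ α)|
        ≤ |target C| + |∑ α ∈ C.ssubsets, dualCoeff mom target α * mom (C \ α)| := abs_sub _ _
      _ ≤ π C + ∑ α ∈ C.ssubsets, (4 * (d : ℝ)) ^ α.card * π C := by
        refine add_le_add (htarget C) ((Finset.abs_sum_le_sum_abs _ _).trans ?_)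
        refine Finset.sum_le_sum fun α hα => ?_
        rw [Finset.mem_ssubsets] at hα
        rw [abs_mul]
        calc |dualCoeff mom target α| * |mom (C \ α)|
            ≤ ((4 * (d : ℝ)) ^ α.card * π α) * π (C \ α) :=
              mul_le_mul (ih α hα ((Finset.card_le_card hα.subset).trans hC)) (hmom _)
                (abs_nonneg _) (mul_nonneg (by positivity) (hπ _))
          _ = (4 * (d : ℝ)) ^ α.card * (π α * π (C \ α)) := mul_assoc _ _ _
          _ ≤ (4 * (d : ℝ)) ^ α.card * π C := by
              gcongr
              exact hmul α C hα.subset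
      _ = (1 + ∑ α ∈ C.ssubsets, (4 * (d : ℝ)) ^ α.card) * π C := by
        rw [← Finset.sum_mul]
        ring
      _ ≤ (4 * (d : ℝ)) ^ C.card * π C :=
        mul_le_mul_of_nonneg_right (one_add_sum_ssubsets_pow_le C hC) (hπ C)

end DualCoefficients

/-! ### Expectations of scores under independent Bernoulli variables. -/

section BernoulliProduct

variable {E : Type*} [Fintype E] [DecidableEq E]

/-- The expectation of `F` under independent Bernoulli variables with parameters `p e`. -/
def bernoulliExp (p : E → ℝ) (F : (E → Bool) → ℝ) : ℝ :=
  ∑ a : E → Bool, (∏ e, if a e then p e else 1 - p e) * F a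

theorem bernoulliExp_add (p : E → ℝ) (F H : (E → Bool) → ℝ) :
    bernoulliExp p (fun a => F a + H a) = bernoulliExp p F + bernoulliExp p H := by
  simp only [bernoulliExp, mul_add, Finset.sum_add_distrib]

theorem bernoulliExp_const_mul (p : E → ℝ) (r : ℝ) (F : (E → Bool) → ℝ) :
    bernoulliExp p (fun a => r * F a) = r * bernoulliExp p F := by
  simp only [bernoulliExp, Finset.mul_sum]
  exact Finset.sum_congr rfl fun a _ => by ring

theorem bernoulliExp_sum {ι : Type*} (p : E → ℝ) (s : Finset ι) (F : ι → (E → Bool) → ℝ) :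
    bernoulliExp p (fun a => ∑ i ∈ s, F i a) = ∑ i ∈ s, bernoulliExp p (F i) := by
  simp only [bernoulliExp, Finset.mul_sum]
  exact Finset.sum_comm

theorem bernoulliExp_nonneg {p : E → ℝ} (hp : ∀ e, p e ∈ Set.Icc 0 1) {F : (E → Bool) → ℝ}
    (hF : ∀ a, 0 ≤ F a) : 0 ≤ bernoulliExp p F := by
  refine Finset.sum_nonneg fun a _ => mul_nonneg (Finset.prod_nonneg fun e _ => ?_) (hF a)
  split_ifs
  · exact (hp e).1
  · linarith [(hp e).2]

theorem bernoulliExp_prod (p : E → ℝ) (g : E → Bool → ℝ) :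
    bernoulliExp p (fun a => ∏ e, g e (a e)) =
      ∏ e, (p e * g e true + (1 - p e) * g e false) := by
  have h := Finset.prod_univ_sum (fun _ : E => (Finset.univ : Finset Bool))
    (fun e b => (if b then p e else 1 - p e) * g e b)
  simp only [Fintype.piFinset_univ, Fintype.sum_bool, if_true, Bool.false_eq_true, if_false] at h
  rw [h, bernoulliExp]
  exact Finset.sum_congr rfl fun a _ => Finset.prod_mul_distrib.symm

theorem bernoulliExp_const (p : E → ℝ) (r : ℝ) : bernoulliExp p (fun _ => r) = r := by
  have h := bernoulliExp_prod p (fun _ _ => 1)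
  simp only [Finset.prod_const_one, mul_one, add_sub_cancel] at h
  have h2 := bernoulliExp_const_mul p r (fun _ => 1)
  rw [h, mul_one] at h2
  simpa using h2

/-- The value in `{0, 1}` of a Boolean. -/
def boolVal (b : Bool) : ℝ := if b then 1 else 0

/-- The centred Bernoulli variable divided by its variance. -/
noncomputable def score (p : ℝ) (b : Bool) : ℝ := (boolVal b - p) / (p * (1 - p))

/-- A score has mean zero and pairs to `1` with `boolVal - q` whatever `q` is. So the scores can
follow the hidden parameters while the polynomials keep a fixed centre; this makes the system
triangular. -/
theorem bernoulliExp_score_mul_centered {p : E → ℝ} (hp : ∀ e, p e ∈ Set.Ioo 0 1) (q : ℝ)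
    (α β : Finset E) :
    bernoulliExp p (fun a => (∏ e ∈ α, score (p e) (a e)) * ∏ e ∈ β, (boolVal (a e) - q)) =
      if α ⊆ β then ∏ e ∈ β \ α, (p e - q) else 0 := by
  have h1 : ∀ a : E → Bool,
      (∏ e ∈ α, score (p e) (a e)) * ∏ e ∈ β, (boolVal (a e) - q) =
      ∏ e, ((if e ∈ α then score (p e) (a e) else 1) * if e ∈ β then boolVal (a e) - q else 1) := by
    intro a
    rw [Finset.prod_mul_distrib, Finset.prod_ite_mem, Finset.prod_ite_mem, Finset.univ_inter,
      Finset.univ_inter]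
  simp only [h1]
  rw [bernoulliExp_prod p (fun e b =>
    (if e ∈ α then score (p e) b else 1) * if e ∈ β then boolVal b - q else 1)]
  have hne : ∀ e, p e ≠ 0 ∧ 1 - p e ≠ 0 := fun e => ⟨(hp e).1.ne', by linarith [(hp e).2]⟩
  split_ifs with h
  · rw [← Finset.univ_inter (β \ α), ← Finset.prod_ite_mem]
    refine Finset.prod_congr rfl fun e _ => ?_
    obtain ⟨h2, h3⟩ := hne e
    by_cases hα : e ∈ α
    · simp only [hα, h hα, if_true, Finset.mem_sdiff, not_true, and_false, if_false, score, boolVal,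
        Bool.false_eq_true]
      field_simp
      ring
    · by_cases hβ : e ∈ β
      · simp [hα, hβ, boolVal]
        ring
      · simp [hα, hβ]
  · obtain ⟨e, hα, hβ⟩ := Finset.not_subset.1 h
    refine Finset.prod_eq_zero (Finset.mem_univ e) ?_
    obtain ⟨h2, h3⟩ := hne e
    simp only [hα, hβ, if_true, if_false, score, boolVal, Bool.false_eq_true]
    field_simp
    ring

theorem bernoulliExp_score_mul_score {p : E → ℝ} (hp : ∀ e, p e ∈ Set.Ioo 0 1)
    (α β : Finset E) :
    bernoulliExp p (fun a => (∏ e ∈ α, score (p e) (a e)) * ∏ e ∈ β, score (p e) (a e)) =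
      if α = β then ∏ e ∈ α, 1 / (p e * (1 - p e)) else 0 := by
  have h1 : ∀ a : E → Bool,
      (∏ e ∈ α, score (p e) (a e)) * ∏ e ∈ β, score (p e) (a e) =
      ∏ e, ((if e ∈ α then score (p e) (a e) else 1) *
        if e ∈ β then score (p e) (a e) else 1) := by
    intro a
    rw [Finset.prod_mul_distrib, Finset.prod_ite_mem, Finset.prod_ite_mem, Finset.univ_inter,
      Finset.univ_inter]
  simp only [h1]
  rw [bernoulliExp_prod p (fun e b =>
    (if e ∈ α then score (p e) b else 1) * if e ∈ β then score (p e) b else 1)]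
  have hne : ∀ e, p e ≠ 0 ∧ 1 - p e ≠ 0 := fun e => ⟨(hp e).1.ne', by linarith [(hp e).2]⟩
  split_ifs with h
  · subst h
    rw [← Finset.univ_inter α, ← Finset.prod_ite_mem]
    refine Finset.prod_congr rfl fun e _ => ?_
    obtain ⟨h2, h3⟩ := hne e
    by_cases hα : e ∈ α
    · simp only [hα, if_true, score, boolVal, Bool.false_eq_true, if_false,
        Finset.univ_inter]
      field_simp
      ring
    · simp only [hα, if_false, Finset.univ_inter]
      ring
  · have h4 : ∃ e, ¬ (e ∈ α ↔ e ∈ β) := by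
      by_contra! h5
      exact h (Finset.ext h5)
    obtain ⟨e, he⟩ := h4
    refine Finset.prod_eq_zero (Finset.mem_univ e) ?_
    obtain ⟨h2, h3⟩ := hne e
    by_cases hα : e ∈ α
    · have hβ : e ∉ β := fun h => he (by simp [hα, h])
      simp only [hα, hβ, if_true, if_false, score, boolVal, Bool.false_eq_true]
      field_simp
      ring
    · have hβ : e ∈ β := by
        by_contra h
        exact he (by simp [hα, h])
      simp only [hα, hβ, if_true, if_false, score, boolVal, Bool.false_eq_true]
      field_simp
      ring

end BernoulliProduct

/-! ### Averages over a finite uniform space. -/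

section Average

variable {Ω : Type*} [Fintype Ω]

/-- The mean of `F` over the uniform distribution on `Ω`. -/
noncomputable def avg (F : Ω → ℝ) : ℝ := (∑ ω, F ω) / Fintype.card Ω

theorem avg_add (F H : Ω → ℝ) : avg (fun ω => F ω + H ω) = avg F + avg H := by
  simp only [avg, Finset.sum_add_distrib, add_div]

theorem avg_const_mul (r : ℝ) (F : Ω → ℝ) : avg (fun ω => r * F ω) = r * avg F := by
  simp only [avg, ← Finset.mul_sum, mul_div_assoc]

theorem avg_sum {ι : Type*} (s : Finset ι) (F : ι → Ω → ℝ) :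
    avg (fun ω => ∑ i ∈ s, F i ω) = ∑ i ∈ s, avg (F i) := by
  simp only [avg]
  rw [Finset.sum_comm, Finset.sum_div]

theorem avg_mono {F H : Ω → ℝ} (h : ∀ ω, F ω ≤ H ω) : avg F ≤ avg H :=
  div_le_div_of_nonneg_right (Finset.sum_le_sum fun ω _ => h ω) (Nat.cast_nonneg _)

theorem avg_nonneg {F : Ω → ℝ} (h : ∀ ω, 0 ≤ F ω) : 0 ≤ avg F :=
  div_nonneg (Finset.sum_nonneg fun ω _ => h ω) (Nat.cast_nonneg _)

theorem abs_avg_le (F : Ω → ℝ) : |avg F| ≤ avg fun ω => |F ω| := by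
  rw [avg, avg, abs_div, Nat.abs_cast]
  exact div_le_div_of_nonneg_right (Finset.abs_sum_le_sum_abs _ _) (Nat.cast_nonneg _)

theorem avg_const [Nonempty Ω] (r : ℝ) : avg (fun _ : Ω => r) = r := by
  have h : (Fintype.card Ω : ℝ) ≠ 0 := Nat.cast_ne_zero.2 Fintype.card_ne_zero
  rw [avg, Finset.sum_const, Finset.card_univ, nsmul_eq_mul, mul_div_cancel_left₀ _ h]

theorem exists_avg_le [Nonempty Ω] (F : Ω → ℝ) : ∃ ω, avg F ≤ F ω := by
  by_contra! h
  have h2 : ∑ ω, F ω < ∑ _ω : Ω, avg F :=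
    Finset.sum_lt_sum_of_nonempty Finset.univ_nonempty fun ω _ => h ω
  have h3 : (0 : ℝ) < Fintype.card Ω := Nat.cast_pos.2 Fintype.card_pos
  rw [Finset.sum_const, Finset.card_univ, nsmul_eq_mul, avg, mul_div_cancel₀ _ h3.ne'] at h2
  exact lt_irrefl _ h2

end Average

/-! ### The dual certificate and the lower bound for low-degree estimation. -/

section LowDegree

variable {E Ω : Type*} [Fintype E] [DecidableEq E] [Fintype Ω]

/-- The joint expectation over a uniform `ω` and, given `ω`, independent Bernoulli variables with
parameters `p ω e`. -/
noncomputable def jointExp (p : Ω → E → ℝ) : (Ω → (E → Bool) → ℝ) →ₗ[ℝ] ℝ where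
  toFun F := avg fun ω => bernoulliExp (p ω) (F ω)
  map_add' F H := by
    rw [← avg_add]
    exact congrArg avg (funext fun ω => bernoulliExp_add _ _ _)
  map_smul' r F := by
    rw [RingHom.id_apply, smul_eq_mul, ← avg_const_mul]
    exact congrArg avg (funext fun ω => bernoulliExp_const_mul _ _ _)

theorem jointExp_apply (p : Ω → E → ℝ) (F : Ω → (E → Bool) → ℝ) :
    jointExp p F = avg fun ω => bernoulliExp (p ω) (F ω) := rfl

theorem jointExp_nonneg {p : Ω → E → ℝ} (hp : ∀ ω e, p ω e ∈ Set.Ioo 0 1)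
    {F : Ω → (E → Bool) → ℝ} (hF : ∀ ω a, 0 ≤ F ω a) : 0 ≤ jointExp p F :=
  avg_nonneg fun ω => bernoulliExp_nonneg (fun e => Set.Ioo_subset_Icc_self (hp ω e)) (hF ω)

/-- The functions of the Bernoulli variables that are polynomials of degree at most `D`. -/
def lowDegreeSpan (E : Type*) (q : ℝ) (D : ℕ) : Submodule ℝ ((E → Bool) → ℝ) :=
  Submodule.span ℝ {g | ∃ β : Finset E, β.card ≤ D ∧ g = fun a => ∏ e ∈ β, (boolVal (a e) - q)}

variable (X : Ω → E → ℝ) (x : Ω → ℝ) (q s : ℝ) (D : ℕ)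

/-- The moments of the signal. -/
noncomputable def moment (β : Finset E) : ℝ := avg fun ω => ∏ e ∈ β, X ω e

/-- The joint moments of the target and the signal. -/
noncomputable def targetMoment (β : Finset E) : ℝ := avg fun ω => x ω * ∏ e ∈ β, X ω e

/-- The random variable with the same correlations as `x` with polynomials of degree at most `D`. -/
noncomputable def dualCertificate (ω : Ω) (a : E → Bool) : ℝ :=
  ∑ α ∈ Finset.univ.filter (fun α : Finset E => α.card ≤ D),
    s ^ α.card * dualCoeff (moment X) (targetMoment X x) α *
      ∏ e ∈ α, score (q + s * X ω e) (a e)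

variable {X x q s D}

theorem jointExp_centered_mul_target (β : Finset E)
    (hp : ∀ ω e, q + s * X ω e ∈ Set.Ioo 0 1) :
    jointExp (fun ω e => q + s * X ω e) (fun ω a => (∏ e ∈ β, (boolVal (a e) - q)) * x ω) =
      s ^ β.card * targetMoment X x β := by
  rw [jointExp_apply, targetMoment, ← avg_const_mul]
  refine congrArg avg (funext fun ω => ?_)
  have h := bernoulliExp_score_mul_centered (hp ω) q ∅ β
  simp only [Finset.prod_empty, one_mul, Finset.empty_subset, if_true, Finset.sdiff_empty,
    add_sub_cancel_left] at h
  have h2 : (fun a : E → Bool => (∏ e ∈ β, (boolVal (a e) - q)) * x ω) =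
      fun a => x ω * ∏ e ∈ β, (boolVal (a e) - q) := funext fun a => mul_comm _ _
  rw [h2, bernoulliExp_const_mul, h, Finset.prod_mul_distrib, Finset.prod_const]
  ring

/-- Given `ω`, only `α ⊆ β` contribute, each leaving the signal on `β \ α`; the powers of `s`
combine to `s ^ β.card`, and averaging yields the defining equation of `dualCoeff` at `β`. -/
theorem jointExp_centered_mul_dualCertificate [Nonempty Ω] (β : Finset E) (hβ : β.card ≤ D)
    (hp : ∀ ω e, q + s * X ω e ∈ Set.Ioo 0 1) :
    jointExp (fun ω e => q + s * X ω e)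
      (fun ω a => (∏ e ∈ β, (boolVal (a e) - q)) * dualCertificate X x q s D ω a) =
      s ^ β.card * targetMoment X x β := by
  have hmom : moment X ∅ = 1 := by simp [moment, avg_const]
  have h1 : ∀ ω, bernoulliExp (fun e => q + s * X ω e)
      (fun a => (∏ e ∈ β, (boolVal (a e) - q)) * dualCertificate X x q s D ω a) =
      ∑ α ∈ β.powerset, s ^ β.card * dualCoeff (moment X) (targetMoment X x) α *
        ∏ e ∈ β \ α, X ω e := by
    intro ω
    have h2 : (fun a : E → Bool =>
        (∏ e ∈ β, (boolVal (a e) - q)) * dualCertificate X x q s D ω a) =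
        fun a => ∑ α ∈ Finset.univ.filter (fun α : Finset E => α.card ≤ D),
          (s ^ α.card * dualCoeff (moment X) (targetMoment X x) α) *
          ((∏ e ∈ α, score (q + s * X ω e) (a e)) * ∏ e ∈ β, (boolVal (a e) - q)) := by
      funext a
      rw [dualCertificate, Finset.mul_sum]
      exact Finset.sum_congr rfl fun α _ => by ring
    rw [h2, bernoulliExp_sum]
    simp only [bernoulliExp_const_mul, bernoulliExp_score_mul_centered (hp ω), add_sub_cancel_left]
    have hsub : β.powerset ⊆ Finset.univ.filter (fun α : Finset E => α.card ≤ D) := by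
      intro α hα
      exact Finset.mem_filter.2 ⟨Finset.mem_univ _,
        (Finset.card_le_card (Finset.mem_powerset.1 hα)).trans hβ⟩
    rw [← Finset.sum_subset hsub]
    · refine Finset.sum_congr rfl fun α hα => ?_
      rw [Finset.mem_powerset] at hα
      rw [if_pos hα, Finset.prod_mul_distrib, Finset.prod_const, Finset.card_sdiff_of_subset hα,
        ← Nat.sub_add_cancel (Finset.card_le_card hα), pow_add, Nat.add_sub_cancel]
      ring
    · intro α _ hα
      rw [if_neg (fun h => hα (Finset.mem_powerset.2 h)), mul_zero]
  rw [jointExp_apply]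
  simp only [h1]
  rw [avg_sum]
  simp only [avg_const_mul]
  rw [← sum_dualCoeff_mul (target := targetMoment X x) hmom β, Finset.mul_sum]
  exact Finset.sum_congr rfl fun α _ => by rw [moment, mul_assoc]

theorem jointExp_lowDegree_mul_dualCertificate [Nonempty Ω]
    (hp : ∀ ω e, q + s * X ω e ∈ Set.Ioo 0 1) {g : (E → Bool) → ℝ}
    (hg : g ∈ lowDegreeSpan E q D) :
    jointExp (fun ω e => q + s * X ω e)
      (fun ω a => g a * (dualCertificate X x q s D ω a - x ω)) = 0 := by
  induction hg using Submodule.span_induction with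
  | mem g hg =>
    obtain ⟨β, hβ, rfl⟩ := hg
    have h := jointExp_centered_mul_dualCertificate (x := x) β hβ hp
    rw [← jointExp_centered_mul_target β hp, ← sub_eq_zero, ← map_sub] at h
    rw [← h]
    congr 1
    funext ω a
    simp only [Pi.sub_apply, mul_sub]
  | zero =>
    rw [← map_zero (jointExp fun ω e => q + s * X ω e)]
    congr 1
    funext ω a
    simp
  | add g h _ _ hg hh =>
    have h0 := congrArg₂ (· + ·) hg hh
    simp only [add_zero, ← map_add] at h0
    rw [← h0]
    congr 1
    funext ω a
    simp only [Pi.add_apply, add_mul]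
  | smul r g _ hg =>
    rw [← mul_zero r, ← hg, ← smul_eq_mul, ← map_smul]
    congr 1
    funext ω a
    simp only [Pi.smul_apply, smul_eq_mul, mul_assoc]

theorem jointExp_dualCertificate_sq_le [Nonempty Ω] (hp : ∀ ω e, q + s * X ω e ∈ Set.Ioo 0 1)
    {r : ℝ} (hr : ∀ ω e, 1 / ((q + s * X ω e) * (1 - (q + s * X ω e))) ≤ r) :
    jointExp (fun ω e => q + s * X ω e) (fun ω a => dualCertificate X x q s D ω a ^ 2) ≤
      ∑ α ∈ Finset.univ.filter (fun α : Finset E => α.card ≤ D),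
        dualCoeff (moment X) (targetMoment X x) α ^ 2 * (s ^ 2 * r) ^ α.card := by
  rw [jointExp_apply, ← avg_const (Ω := Ω) (∑ α ∈ Finset.univ.filter _, _)]
  refine avg_mono fun ω => ?_
  set w := dualCoeff (moment X) (targetMoment X x) with hw
  have h2 : (fun a : E → Bool => dualCertificate X x q s D ω a ^ 2) =
      fun a => ∑ α ∈ Finset.univ.filter (fun α : Finset E => α.card ≤ D),
        ∑ β ∈ Finset.univ.filter (fun α : Finset E => α.card ≤ D),
        (s ^ α.card * w α * (s ^ β.card * w β)) *
        ((∏ e ∈ α, score (q + s * X ω e) (a e)) * ∏ e ∈ β, score (q + s * X ω e) (a e)) := by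
    funext a
    rw [dualCertificate, sq, Finset.sum_mul_sum]
    exact Finset.sum_congr rfl fun α _ => Finset.sum_congr rfl fun β _ => by ring
  rw [h2, bernoulliExp_sum]
  refine Finset.sum_le_sum fun α hα => ?_
  rw [bernoulliExp_sum]
  simp only [bernoulliExp_const_mul, bernoulliExp_score_mul_score (hp ω), mul_ite, mul_zero]
  rw [Finset.sum_ite_eq, if_pos hα]
  have h3 : ∏ e ∈ α, 1 / ((q + s * X ω e) * (1 - (q + s * X ω e))) ≤ r ^ α.card := by
    rw [← Finset.prod_const]
    refine Finset.prod_le_prod (fun e _ => ?_) fun e _ => hr ω e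
    have := hp ω e
    exact one_div_nonneg.2 (mul_nonneg this.1.le (by linarith [this.2]))
  calc s ^ α.card * w α * (s ^ α.card * w α) *
        ∏ e ∈ α, 1 / ((q + s * X ω e) * (1 - (q + s * X ω e)))
      = (s ^ α.card * w α) ^ 2 * ∏ e ∈ α, 1 / ((q + s * X ω e) * (1 - (q + s * X ω e))) := by ring
    _ ≤ (s ^ α.card * w α) ^ 2 * r ^ α.card := mul_le_mul_of_nonneg_left h3 (sq_nonneg _)
    _ = w α ^ 2 * (s ^ 2 * r) ^ α.card := by
      rw [mul_pow, mul_pow, ← pow_mul, ← pow_mul, mul_comm 2]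
      ring

/-- Expand the square around the certificate `U`: the cross term pairs `g` with `U - x` and
vanishes, and the square of `g - s * U` is dropped. -/
theorem le_jointExp_sub_sq [Nonempty Ω] (hp : ∀ ω e, q + s * X ω e ∈ Set.Ioo 0 1)
    {r : ℝ} (hr : ∀ ω e, 1 / ((q + s * X ω e) * (1 - (q + s * X ω e))) ≤ r)
    {g : (E → Bool) → ℝ} (hg : g ∈ lowDegreeSpan E q D) :
    s ^ 2 * (avg (fun ω => x ω ^ 2) - ∑ α ∈ Finset.univ.filter (fun α : Finset E => α.card ≤ D),
        dualCoeff (moment X) (targetMoment X x) α ^ 2 * (s ^ 2 * r) ^ α.card) ≤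
      jointExp (fun ω e => q + s * X ω e) (fun ω a => (g a - s * x ω) ^ 2) := by
  set U := dualCertificate X x q s D with hU
  set J := jointExp (fun ω e => q + s * X ω e) with hJ
  have h1 : (fun ω a => (g a - s * x ω) ^ 2 : Ω → (E → Bool) → ℝ) =
      (fun ω a => (g a - s * U ω a) ^ 2) + (2 * s) • (fun ω a => g a * (U ω a - x ω)) +
        s ^ 2 • (fun ω _ => x ω ^ 2 : Ω → (E → Bool) → ℝ) - s ^ 2 • fun ω a => U ω a ^ 2 := by
    funext ω a
    simp only [Pi.add_apply, Pi.sub_apply, Pi.smul_apply, smul_eq_mul]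
    ring
  have h2 : J (fun ω _ => x ω ^ 2 : Ω → (E → Bool) → ℝ) = avg (fun ω => x ω ^ 2) := by
    rw [hJ, jointExp_apply]
    simp only [bernoulliExp_const]
  have h3 := jointExp_dualCertificate_sq_le (D := D) (x := x) hp hr
  have h4 : 0 ≤ J (fun ω a => (g a - s * U ω a) ^ 2) := jointExp_nonneg hp fun _ _ => sq_nonneg _
  rw [h1, map_sub, map_add, map_add, map_smul, map_smul, map_smul,
    jointExp_lowDegree_mul_dualCertificate hp hg, h2, smul_zero, smul_eq_mul, smul_eq_mul, mul_sub]
  have h5 := mul_le_mul_of_nonneg_left h3 (sq_nonneg s)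
  linarith

end LowDegree

/-! ### Agreement of uniform labels along a graph. -/

section Agreement

variable {n : ℕ} (G : Type*) [Fintype G] [DecidableEq G]

/-- The labellings that agree on the endpoints of every pair in `C`. -/
def agreeing (C : Finset (VertexPair n)) : Finset (Fin n → G) :=
  Finset.univ.filter fun c => ∀ e ∈ C, c e.1.1 = c e.1.2

/-- The probability that a uniform labelling agrees on the endpoints of every pair in `C`. -/
noncomputable def agreeProb (C : Finset (VertexPair n)) : ℝ :=
  (agreeing G C).card / (Fintype.card G : ℝ) ^ n

variable {G}

theorem mem_agreeing {C : Finset (VertexPair n)} {c : Fin n → G} :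
    c ∈ agreeing G C ↔ ∀ e ∈ C, c e.1.1 = c e.1.2 := by
  simp [agreeing]

theorem agreeProb_nonneg (C : Finset (VertexPair n)) : 0 ≤ agreeProb G C := by
  unfold agreeProb
  positivity

theorem pow_card_le_card_agreeing_singleton (e : VertexPair n) :
    Fintype.card G ^ n ≤ (agreeing G {e}).card * Fintype.card G := by
  have h : (Finset.univ : Finset (Fin n → G)).card ≤
      (agreeing G {e} ×ˢ (Finset.univ : Finset G)).card := by
    -- Forcing agreement overwrites one label; recording the old value makes the map injective.
    refine Finset.card_le_card_of_injOn
      (fun c => (Function.update c e.1.2 (c e.1.1), c e.1.2)) ?_ ?_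
    · intro c _
      simp only [Finset.coe_product, Finset.coe_univ, Set.mem_prod, Finset.mem_coe, mem_agreeing,
        Finset.mem_singleton, Set.mem_univ, and_true]
      rintro f rfl
      rw [Function.update_self, Function.update_of_ne f.2.ne]
    · intro c _ d _ h
      simp only [Prod.mk.injEq] at h
      funext v
      by_cases hv : v = e.1.2
      · rw [hv, h.2]
      · have := congrFun h.1 v
        rwa [Function.update_of_ne hv, Function.update_of_ne hv] at this
  simpa [Finset.card_product] using h

/-- Agreeing labellings form subgroups `A` and `B`, and `|A| |B| ≤ |A ∩ B| |A - B|`: fibres of the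
difference map are translates of the intersection. The group structure on labels serves only this
positive correlation. -/
theorem card_agreeing_mul_le [AddCommGroup G] (C C' : Finset (VertexPair n)) :
    (agreeing G C).card * (agreeing G C').card ≤
      (agreeing G (C ∪ C')).card * Fintype.card G ^ n := by
  rw [← Finset.card_product]
  refine (Finset.card_le_mul_card_image (f := fun z : (Fin n → G) × (Fin n → G) => z.1 - z.2)
    _ (agreeing G (C ∪ C')).card ?_).trans (Nat.mul_le_mul_left _ ?_)
  · intro t ht
    obtain ⟨⟨a, b⟩, hab, rfl⟩ := Finset.mem_image.1 ht
    simp only [Finset.mem_product, mem_agreeing] at hab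
    refine Finset.card_le_card_of_injOn (fun z => z.1 - a) ?_ ?_
    · rintro ⟨a', b'⟩ hz
      simp only [Finset.coe_filter, Finset.mem_product, mem_agreeing, Set.mem_ofPred_eq] at hz
      obtain ⟨⟨h1, h2⟩, h3⟩ := hz
      have h4 : a' - a = b' - b := by
        rw [sub_eq_sub_iff_add_eq_add] at h3 ⊢
        rw [h3, add_comm]
      simp only [Finset.mem_coe, mem_agreeing, Finset.mem_union]
      rintro e (he | he)
      · rw [Pi.sub_apply, Pi.sub_apply, h1 e he, hab.1 e he]
      · rw [h4, Pi.sub_apply, Pi.sub_apply, h2 e he, hab.2 e he]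
    · rintro ⟨a', b'⟩ hz ⟨a'', b''⟩ hz' h
      simp only [Finset.coe_filter, Finset.mem_product, Set.mem_ofPred_eq] at hz hz'
      have h1 : a' = a'' := sub_left_injective h
      have h2 := hz.2.trans hz'.2.symm
      rw [h1] at h2
      rw [h1, sub_right_injective h2]
  · refine (Finset.card_le_univ _).trans ?_
    simp

theorem agreeProb_mul_le [AddCommGroup G] (C C' : Finset (VertexPair n)) :
    agreeProb G C * agreeProb G C' ≤ agreeProb G (C ∪ C') := by
  have hG : (0 : ℝ) < (Fintype.card G : ℝ) ^ n := by
    have : 0 < Fintype.card G := Fintype.card_pos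
    positivity
  rw [agreeProb, agreeProb, agreeProb, div_mul_div_comm, div_le_div_iff₀ (mul_pos hG hG) hG,
    ← mul_assoc]
  refine mul_le_mul_of_nonneg_right ?_ hG.le
  exact_mod_cast card_agreeing_mul_le C C'

theorem pow_card_le_card_agreeing [AddCommGroup G] (C : Finset (VertexPair n)) :
    Fintype.card G ^ n ≤ (agreeing G C).card * Fintype.card G ^ C.card := by
  have hG : 0 < Fintype.card G ^ n := pow_pos Fintype.card_pos _
  induction C using Finset.induction_on with
  | empty => simp [agreeing]
  | insert e C he ih =>
    refine Nat.le_of_mul_le_mul_right (c := Fintype.card G ^ n) ?_ hG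
    have h1 := card_agreeing_mul_le (G := G) {e} C
    rw [← Finset.insert_eq] at h1
    rw [Finset.card_insert_of_notMem he]
    calc Fintype.card G ^ n * Fintype.card G ^ n
        ≤ ((agreeing G {e}).card * Fintype.card G) *
          ((agreeing G C).card * Fintype.card G ^ C.card) :=
          Nat.mul_le_mul (pow_card_le_card_agreeing_singleton e) ih
      _ = ((agreeing G {e}).card * (agreeing G C).card) * Fintype.card G ^ (C.card + 1) := by ring
      _ ≤ ((agreeing G (insert e C)).card * Fintype.card G ^ n) * Fintype.card G ^ (C.card + 1) :=
          Nat.mul_le_mul_right _ h1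
      _ = _ := by ring

end Agreement

/-! ### Anchored graphs: agreement probability and counting. -/

section Anchored

variable {n : ℕ} (p : VertexPair n)

/-- No pair in `C` has exactly one endpoint in `S`. -/
def IsClosedUnder (C : Finset (VertexPair n)) (S : Finset (Fin n)) : Prop :=
  ∀ e ∈ C, e.1.1 ∈ S ↔ e.1.2 ∈ S

/-- The graph `C` connects the endpoints of `p` and has no further component with an edge. -/
def Anchored (C : Finset (VertexPair n)) : Prop :=
  ∀ S : Finset (Fin n), p.1.1 ∈ S → IsClosedUnder C S → p.1.2 ∈ S ∧ ∀ e ∈ C, e.1.1 ∈ S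

/-- The vertices of `C` and of `p`. -/
def support (C : Finset (VertexPair n)) : Finset (Fin n) :=
  {p.1.1, p.1.2} ∪ (C.image (fun e => e.1.1) ∪ C.image (fun e => e.1.2))

variable {p}

theorem Anchored.eq_of_mem_support {G : Type*} [DecidableEq G] {C : Finset (VertexPair n)}
    (hC : Anchored p C) {c : Fin n → G} (hc : ∀ e ∈ C, c e.1.1 = c e.1.2) {v : Fin n}
    (hv : v ∈ support p C) : c v = c p.1.1 := by
  have h := hC (Finset.univ.filter fun v => c v = c p.1.1) (by simp) (fun e he => by
    simp [hc e he])
  simp only [Finset.mem_filter, Finset.mem_univ, true_and] at h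
  simp only [support, Finset.mem_union, Finset.mem_insert, Finset.mem_singleton,
    Finset.mem_image] at hv
  rcases hv with (rfl | rfl) | ⟨e, he, rfl⟩ | ⟨e, he, rfl⟩
  · rfl
  · exact h.1
  · exact h.2 e he
  · rw [← hc e he, h.2 e he]

/-- An agreeing labelling is constant on the support, so it is determined by one label there and its
values elsewhere. The freed coordinates can store an arbitrary labelling of the support. -/
theorem Anchored.card_agreeing_mul_le (G : Type*) [Fintype G] [DecidableEq G]
    {C : Finset (VertexPair n)} (hC : Anchored p C) :
    (agreeing G C).card * Fintype.card G ^ (support p C).card ≤ Fintype.card G ^ (n + 1) := by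
  have h : (agreeing G C ×ˢ (Finset.univ : Finset (support p C → G))).card ≤
      (Finset.univ : Finset (G × (Fin n → G))).card := by
    refine Finset.card_le_card_of_injOn
      (fun z => (z.1 p.1.1, fun v => if h : v ∈ support p C then z.2 ⟨v, h⟩ else z.1 v))
      (fun _ _ => by simp) ?_
    rintro ⟨c, d⟩ hz ⟨c', d'⟩ hz' h
    simp only [Finset.coe_product, Set.mem_prod, Finset.mem_coe, mem_agreeing] at hz hz'
    simp only [Prod.mk.injEq] at h
    have h2 : c = c' := by
      funext v
      by_cases hv : v ∈ support p C
      · rw [hC.eq_of_mem_support hz.1 hv, hC.eq_of_mem_support hz'.1 hv, h.1]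
      · have := congrFun h.2 v
        simpa [hv] using this
    have h3 : d = d' := by
      funext v
      have := congrFun h.2 v.1
      simpa [v.2] using this
    rw [h2, h3]
  simpa [Finset.card_product, pow_succ, mul_comm] using h

/-- A connected graph has at most one more vertex than edges. Instead of spanning trees, this
compares upper and lower counts of agreeing two-colourings. -/
theorem Anchored.card_support_le {C : Finset (VertexPair n)} (hC : Anchored p C) :
    (support p C).card ≤ C.card + 1 := by
  have h1 := hC.card_agreeing_mul_le (ZMod 2)
  have h2 := pow_card_le_card_agreeing (G := ZMod 2) C
  rw [ZMod.card] at h1 h2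
  have h3 : 2 ^ n * 2 ^ (support p C).card ≤ 2 ^ n * 2 ^ (C.card + 1) :=
    calc 2 ^ n * 2 ^ (support p C).card
        ≤ ((agreeing (ZMod 2) C).card * 2 ^ C.card) * 2 ^ (support p C).card :=
          Nat.mul_le_mul_right _ h2
      _ = ((agreeing (ZMod 2) C).card * 2 ^ (support p C).card) * 2 ^ C.card := by ring
      _ ≤ 2 ^ (n + 1) * 2 ^ C.card := Nat.mul_le_mul_right _ h1
      _ = 2 ^ n * 2 ^ (C.card + 1) := by ring
  exact (Nat.pow_le_pow_iff_right (by norm_num)).1 (Nat.le_of_mul_le_mul_left h3 (by positivity))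

theorem endpoints_subset_support (C : Finset (VertexPair n)) :
    {p.1.1, p.1.2} ⊆ support p C := Finset.subset_union_left

theorem fst_mem_support {C : Finset (VertexPair n)} {e : VertexPair n} (he : e ∈ C) :
    e.1.1 ∈ support p C :=
  Finset.mem_union_right _ (Finset.mem_union_left _ (Finset.mem_image_of_mem _ he))

theorem snd_mem_support {C : Finset (VertexPair n)} {e : VertexPair n} (he : e ∈ C) :
    e.1.2 ∈ support p C :=
  Finset.mem_union_right _ (Finset.mem_union_right _ (Finset.mem_image_of_mem _ he))

theorem two_le_card_support (C : Finset (VertexPair n)) : 2 ≤ (support p C).card := by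
  rw [← Finset.card_pair p.2.ne]
  exact Finset.card_le_card (endpoints_subset_support C)

theorem Anchored.agreeProb_le {G : Type*} [Fintype G] [DecidableEq G] [Nonempty G]
    {C : Finset (VertexPair n)} (hC : Anchored p C) :
    agreeProb G C ≤ 1 / (Fintype.card G : ℝ) ^ ((support p C).card - 1) := by
  have hG : (0 : ℝ) < Fintype.card G := Nat.cast_pos.2 Fintype.card_pos
  have h1 := two_le_card_support (p := p) C
  rw [agreeProb, div_le_div_iff₀ (by positivity) (by positivity), one_mul]
  refine le_of_mul_le_mul_right ?_ hG
  rw [mul_assoc, ← pow_succ, Nat.sub_add_cancel (by omega), ← pow_succ]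
  exact_mod_cast hC.card_agreeing_mul_le G

/-- Choose the `v` vertices other than the endpoints of `p`, then `m` edges among at most `(2m)²`
pairs; `v < m` gives `v + 2 ≤ 2m`. -/
theorem card_filter_support_le {m v : ℕ} (hv : v < m) :
    (Finset.univ.filter fun C : Finset (VertexPair n) =>
      C.card = m ∧ (support p C).card = v + 2).card ≤ n ^ v * (4 * m ^ 2) ^ m := by
  classical
  let pairs : Finset (Fin n) → Finset (VertexPair n) := fun T =>
    Finset.univ.filter fun e => e.1.1 ∈ {p.1.1, p.1.2} ∪ T ∧ e.1.2 ∈ {p.1.1, p.1.2} ∪ T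
  have hpairs : ∀ T : Finset (Fin n), T.card = v → (pairs T).card ≤ 4 * m ^ 2 := by
    intro T hT
    have h1 : ({p.1.1, p.1.2} ∪ T).card ≤ 2 * m := by
      refine (Finset.card_union_le _ _).trans ?_
      rw [hT, Finset.card_pair p.2.ne]
      omega
    calc (pairs T).card ≤ (({p.1.1, p.1.2} ∪ T) ×ˢ ({p.1.1, p.1.2} ∪ T)).card :=
          Finset.card_le_card_of_injOn Subtype.val
            (fun e he => by
              simpa only [pairs, Finset.coe_filter, Finset.mem_univ, true_and, Set.mem_ofPred_eq,
                Finset.mem_coe, Finset.mem_product] using he)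
            Subtype.val_injective.injOn
      _ ≤ (2 * m) * (2 * m) := by
          rw [Finset.card_product]
          exact Nat.mul_le_mul h1 h1
      _ = 4 * m ^ 2 := by ring
  have hsub : (Finset.univ.filter fun C : Finset (VertexPair n) =>
      C.card = m ∧ (support p C).card = v + 2) ⊆
      (Finset.powersetCard v Finset.univ).biUnion fun T => Finset.powersetCard m (pairs T) := by
    intro C hC
    simp only [Finset.mem_filter, Finset.mem_univ, true_and] at hC
    have hsupp : {p.1.1, p.1.2} ∪ (support p C \ {p.1.1, p.1.2}) = support p C :=
      Finset.union_sdiff_of_subset (endpoints_subset_support C)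
    refine Finset.mem_biUnion.2 ⟨support p C \ {p.1.1, p.1.2}, ?_, ?_⟩
    · rw [Finset.mem_powersetCard]
      refine ⟨Finset.subset_univ _, ?_⟩
      rw [Finset.card_sdiff_of_subset (endpoints_subset_support C), Finset.card_pair p.2.ne, hC.2]
      rfl
    · rw [Finset.mem_powersetCard]
      refine ⟨fun e he => ?_, hC.1⟩
      rw [Finset.mem_filter, hsupp]
      exact ⟨Finset.mem_univ _, fst_mem_support he, snd_mem_support he⟩
  refine (Finset.card_le_card hsub).trans (Finset.card_biUnion_le.trans ?_)
  calc ∑ T ∈ Finset.powersetCard v Finset.univ, (Finset.powersetCard m (pairs T)).card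
      ≤ ∑ _T ∈ Finset.powersetCard v (Finset.univ : Finset (Fin n)), (4 * m ^ 2) ^ m := by
        refine Finset.sum_le_sum fun T hT => ?_
        rw [Finset.card_powersetCard]
        exact (Nat.choose_le_pow _ _).trans
          (Nat.pow_le_pow_left (hpairs T (Finset.mem_powersetCard.1 hT).2) _)
    _ ≤ n ^ v * (4 * m ^ 2) ^ m := by
        rw [Finset.sum_const, Finset.card_powersetCard, Finset.card_univ, Fintype.card_fin,
          smul_eq_mul]
        exact Nat.mul_le_mul_right _ (Nat.choose_le_pow _ _)

open Classical in
theorem sum_anchored_agreeProb_sq_le {G : Type*} [Fintype G] [DecidableEq G] [Nonempty G]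
    (hG : (Fintype.card G : ℝ) ^ 2 ≤ n) (m : ℕ) :
    ∑ C ∈ Finset.univ.filter (fun C : Finset (VertexPair n) => C.card = m ∧ Anchored p C),
      agreeProb G C ^ 2 * ((Fintype.card G : ℝ) ^ 2 / n) ^ m ≤ (4 * (m : ℝ) ^ 2) ^ m * m / n := by
  set K : ℝ := (Fintype.card G : ℝ) with hKdef
  have hK : 0 < K := Nat.cast_pos.2 Fintype.card_pos
  have hn : (0 : ℝ) < n := lt_of_lt_of_le (by positivity) hG
  set A := Finset.univ.filter (fun C : Finset (VertexPair n) => C.card = m ∧ Anchored p C)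
  have hmaps : ∀ C ∈ A, (support p C).card - 2 ∈ Finset.range m := by
    intro C hC
    obtain ⟨-, h1, h2⟩ := Finset.mem_filter.1 hC
    have := h2.card_support_le
    have := two_le_card_support (p := p) C
    rw [Finset.mem_range]
    omega
  rw [← Finset.sum_fiberwise_of_maps_to hmaps]
  have hterm : ∀ v ∈ Finset.range m,
      ∑ C ∈ A.filter (fun C => (support p C).card - 2 = v),
        agreeProb G C ^ 2 * (K ^ 2 / n) ^ m ≤ (4 * (m : ℝ) ^ 2) ^ m / n := by
    intro v hv
    rw [Finset.mem_range] at hv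
    have hcard : ((A.filter (fun C => (support p C).card - 2 = v)).card : ℝ) ≤
        (n : ℝ) ^ v * (4 * (m : ℝ) ^ 2) ^ m := by
      have h1 : A.filter (fun C => (support p C).card - 2 = v) ⊆
          Finset.univ.filter fun C : Finset (VertexPair n) =>
            C.card = m ∧ (support p C).card = v + 2 := by
        intro C hC
        simp only [A, Finset.mem_filter, Finset.mem_univ, true_and] at hC ⊢
        have := two_le_card_support (p := p) C
        exact ⟨hC.1.1, by omega⟩
      exact_mod_cast (Finset.card_le_card h1).trans (card_filter_support_le hv)
    have hle : ∀ C ∈ A.filter (fun C => (support p C).card - 2 = v),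
        agreeProb G C ^ 2 * (K ^ 2 / n) ^ m ≤ (1 / K ^ (v + 1)) ^ 2 * (K ^ 2 / n) ^ m := by
      intro C hC
      simp only [A, Finset.mem_filter, Finset.mem_univ, true_and] at hC
      have h1 := hC.1.2.agreeProb_le (G := G)
      have h2 := two_le_card_support (p := p) C
      rw [show (support p C).card - 1 = v + 1 by omega] at h1
      refine mul_le_mul_of_nonneg_right ?_ (by positivity)
      exact pow_le_pow_left₀ (agreeProb_nonneg C) h1 2
    have hpow : (1 / K ^ (v + 1)) ^ 2 * (K ^ 2 / n) ^ m * (n : ℝ) ^ v ≤ 1 / n := by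
      -- Here `u` counts the edges beyond a spanning tree; each contributes a factor `K ^ 2 / n ≤
      -- 1`, while the tree part leaves exactly `1 / n`.
      obtain ⟨u, rfl⟩ : ∃ u, m = v + 1 + u := ⟨m - (v + 1), by omega⟩
      have h1 : (1 / K ^ (v + 1)) ^ 2 * (K ^ 2 / n) ^ (v + 1 + u) * (n : ℝ) ^ v =
          (K ^ 2 / n) ^ u / n := by
        simp only [div_pow, one_pow]
        field_simp
        ring
      rw [h1]
      gcongr
      exact pow_le_one₀ (by positivity) ((div_le_one hn).2 hG)
    calc ∑ C ∈ A.filter (fun C => (support p C).card - 2 = v), agreeProb G C ^ 2 * (K ^ 2 / n) ^ m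
        ≤ (A.filter (fun C => (support p C).card - 2 = v)).card *
          ((1 / K ^ (v + 1)) ^ 2 * (K ^ 2 / n) ^ m) := by
          rw [← nsmul_eq_mul]
          exact Finset.sum_le_card_nsmul _ _ _ hle
      _ ≤ ((n : ℝ) ^ v * (4 * (m : ℝ) ^ 2) ^ m) * ((1 / K ^ (v + 1)) ^ 2 * (K ^ 2 / n) ^ m) :=
          mul_le_mul_of_nonneg_right hcard (by positivity)
      _ = (4 * (m : ℝ) ^ 2) ^ m * ((1 / K ^ (v + 1)) ^ 2 * (K ^ 2 / n) ^ m * (n : ℝ) ^ v) := by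
          ring
      _ ≤ (4 * (m : ℝ) ^ 2) ^ m * (1 / n) := mul_le_mul_of_nonneg_left hpow (by positivity)
      _ = _ := by ring
  refine (Finset.sum_le_sum hterm).trans (le_of_eq ?_)
  rw [Finset.sum_const, Finset.card_range, nsmul_eq_mul]
  ring

end Anchored

/-! ### Summing the squared coefficients over all graphs. -/

section CertificateSize

/-- The subtracted power is slack that lets the bound be proved by induction; only the constant `1 /
2` is used later. -/
theorem sum_range_mul_pow_le (N : ℕ) :
    ∑ m ∈ Finset.range N, (m : ℝ) * (1 / 8) ^ m ≤ 1 / 2 - (1 / 2) ^ (N + 1) := by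
  induction N with
  | zero => norm_num
  | succ N ih =>
    rw [Finset.sum_range_succ]
    have h1 : (N : ℝ) * (1 / 8) ^ N ≤ (1 / 2) ^ (N + 2) := by
      have h2 : (N : ℝ) ≤ 2 ^ N := by exact_mod_cast Nat.lt_two_pow_self.le
      have h3 : N = 0 ∨ 1 ≤ N := by omega
      rcases h3 with rfl | h3
      · norm_num
      · have h4 : (4 * N : ℝ) ≤ 4 ^ N := by
          have h5 : ∀ m : ℕ, 4 * (m + 1) ≤ 4 ^ (m + 1) := by
            intro m
            induction m with
            | zero => norm_num
            | succ m ih =>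
              rw [pow_succ]
              omega
          obtain ⟨m, rfl⟩ : ∃ m, N = m + 1 := ⟨N - 1, by omega⟩
          exact_mod_cast h5 m
        have h6 : (1 / 8 : ℝ) ^ N = (1 / 2) ^ N * (1 / 4) ^ N := by
          rw [← mul_pow]
          norm_num
        have h7 : (4 : ℝ) ^ N * (1 / 4) ^ N = 1 := by
          rw [← mul_pow]
          norm_num
        calc (N : ℝ) * (1 / 8) ^ N = (4 * N) * (1 / 4) ^ N * ((1 / 2) ^ N * (1 / 4)) := by
              rw [h6]
              ring
          _ ≤ 4 ^ N * (1 / 4) ^ N * ((1 / 2) ^ N * (1 / 4)) := by gcongr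
          _ = (1 / 2) ^ (N + 2) := by
              rw [h7]
              ring
    have h2 : (1 / 2 : ℝ) ^ (N + 1) = 2 * (1 / 2) ^ (N + 2) := by ring
    have h3 : (1 / 2 : ℝ) ^ (N + 1 + 1) = (1 / 2) ^ (N + 2) := rfl
    linarith

open Classical in
theorem sum_sq_mul_pow_le {n : ℕ} {p : VertexPair n} {G : Type*} [Fintype G] [DecidableEq G]
    [Nonempty G] (hG : (Fintype.card G : ℝ) ^ 2 ≤ n) {D : ℕ} (hD : 1 ≤ D)
    {w : Finset (VertexPair n) → ℝ}
    (hw : ∀ C, C.card ≤ D → |w C| ≤ (4 * (D : ℝ)) ^ C.card * agreeProb G C)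
    (hw0 : ∀ C, ¬ Anchored p C → w C = 0) {t : ℝ} (ht0 : 0 ≤ t) (ht : t ≤ 1 / 512) :
    ∑ C ∈ Finset.univ.filter (fun C : Finset (VertexPair n) => C.card ≤ D),
      w C ^ 2 * (t * ((Fintype.card G : ℝ) ^ 2 / n) / (D : ℝ) ^ 4) ^ C.card ≤ 1 / (2 * n) := by
  set K : ℝ := (Fintype.card G : ℝ) with hKdef
  have hK : 0 < K := Nat.cast_pos.2 Fintype.card_pos
  have hn : (0 : ℝ) < n := lt_of_lt_of_le (by positivity) hG
  have hD' : (1 : ℝ) ≤ D := by exact_mod_cast hD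
  have hmaps : ∀ C ∈ Finset.univ.filter (fun C : Finset (VertexPair n) => C.card ≤ D),
      C.card ∈ Finset.range (D + 1) := by
    intro C hC
    have := (Finset.mem_filter.1 hC).2
    rw [Finset.mem_range]
    omega
  rw [← Finset.sum_fiberwise_of_maps_to hmaps]
  have hterm : ∀ m ∈ Finset.range (D + 1),
      ∑ C ∈ (Finset.univ.filter (fun C : Finset (VertexPair n) => C.card ≤ D)).filter
        (fun C => C.card = m), w C ^ 2 * (t * (K ^ 2 / n) / (D : ℝ) ^ 4) ^ C.card ≤
      m * (1 / 8) ^ m / n := by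
    intro m hm
    rw [Finset.mem_range] at hm
    have hm' : (m : ℝ) ≤ D := by exact_mod_cast (by omega : m ≤ D)
    have hsub : Finset.univ.filter (fun C : Finset (VertexPair n) => C.card = m ∧ Anchored p C) ⊆
        (Finset.univ.filter (fun C : Finset (VertexPair n) => C.card ≤ D)).filter
        (fun C => C.card = m) := by
      intro C hC
      simp only [Finset.mem_filter, Finset.mem_univ, true_and] at hC ⊢
      omega
    rw [← Finset.sum_subset hsub]
    · calc ∑ C ∈ Finset.univ.filter (fun C : Finset (VertexPair n) => C.card = m ∧ Anchored p C),
            w C ^ 2 * (t * (K ^ 2 / n) / (D : ℝ) ^ 4) ^ C.card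
          ≤ ∑ C ∈ Finset.univ.filter
              (fun C : Finset (VertexPair n) => C.card = m ∧ Anchored p C),
            (16 * t / (D : ℝ) ^ 2) ^ m * (agreeProb G C ^ 2 * (K ^ 2 / n) ^ m) := by
            refine Finset.sum_le_sum fun C hC => ?_
            obtain ⟨-, h1, -⟩ := Finset.mem_filter.1 hC
            have h2 := hw C (by omega)
            have h3 : w C ^ 2 ≤ ((4 * (D : ℝ)) ^ C.card * agreeProb G C) ^ 2 := by
              rw [← sq_abs]
              exact pow_le_pow_left₀ (abs_nonneg _) h2 2
            rw [h1] at h3 ⊢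
            calc w C ^ 2 * (t * (K ^ 2 / n) / (D : ℝ) ^ 4) ^ m
                ≤ ((4 * (D : ℝ)) ^ m * agreeProb G C) ^ 2 *
                  (t * (K ^ 2 / n) / (D : ℝ) ^ 4) ^ m :=
                  mul_le_mul_of_nonneg_right h3 (by positivity)
              _ = ((4 * (D : ℝ)) ^ 2 * (t * (K ^ 2 / n) / (D : ℝ) ^ 4)) ^ m *
                  agreeProb G C ^ 2 := by
                  rw [mul_pow, mul_pow ((4 * (D : ℝ)) ^ 2), pow_right_comm (4 * (D : ℝ))]
                  ring
              _ = (16 * t / (D : ℝ) ^ 2 * (K ^ 2 / n)) ^ m * agreeProb G C ^ 2 := by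
                  congr 2
                  field_simp
                  ring
              _ = _ := by
                  rw [mul_pow]
                  ring
        _ = (16 * t / (D : ℝ) ^ 2) ^ m * ∑ C ∈ Finset.univ.filter
              (fun C : Finset (VertexPair n) => C.card = m ∧ Anchored p C),
              agreeProb G C ^ 2 * (K ^ 2 / n) ^ m := by rw [Finset.mul_sum]
        _ ≤ (16 * t / (D : ℝ) ^ 2) ^ m * ((4 * (m : ℝ) ^ 2) ^ m * m / n) :=
            mul_le_mul_of_nonneg_left (sum_anchored_agreeProb_sq_le hG m) (by positivity)
        _ = (16 * t / (D : ℝ) ^ 2 * (4 * (m : ℝ) ^ 2)) ^ m * (m / n) := by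
            rw [mul_pow (16 * t / (D : ℝ) ^ 2) (4 * (m : ℝ) ^ 2) m]
            ring
        _ ≤ (1 / 8) ^ m * (m / n) := by
            refine mul_le_mul_of_nonneg_right (pow_le_pow_left₀ (by positivity) ?_ m)
              (by positivity)
            -- The `D ^ 4` in the scaling is spent here: `D ^ 2` on the squared coefficient bound
            -- and `D ^ 2` on the graph count. The threshold `1 / 512` makes `64 * t ≤ 1 / 8`.
            calc 16 * t / (D : ℝ) ^ 2 * (4 * (m : ℝ) ^ 2)
                ≤ 16 * t / (D : ℝ) ^ 2 * (4 * (D : ℝ) ^ 2) := by gcongr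
              _ = 64 * t := by
                field_simp
                ring
              _ ≤ 1 / 8 := by linarith
        _ = m * (1 / 8) ^ m / n := by ring
    · intro C hC hC'
      simp only [Finset.mem_filter, Finset.mem_univ, true_and] at hC hC'
      rw [hw0 C fun h => hC' ⟨hC.2, h⟩]
      ring
  calc _ ≤ ∑ m ∈ Finset.range (D + 1), (m : ℝ) * (1 / 8) ^ m / n := Finset.sum_le_sum hterm
    _ = (∑ m ∈ Finset.range (D + 1), (m : ℝ) * (1 / 8) ^ m) / n := by rw [Finset.sum_div]
    _ ≤ (1 / 2) / n := by
        gcongr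
        have h1 := sum_range_mul_pow_le (D + 1)
        have h2 : (0 : ℝ) ≤ (1 / 2) ^ (D + 1 + 1) := by positivity
        linarith
    _ = 1 / (2 * n) := by
        field_simp

end CertificateSize

/-! ### Independence of functions of disjoint sets of vertices. -/

/-- Exchanging the part seen by `H` between two independent copies is an involution of `Ω × Ω`,
hence preserves the sum, and it turns `F a * H a` into `F a * H b`. -/
theorem avg_mul_of_swap {Ω : Type*} [Fintype Ω] [Nonempty Ω] (mix : Ω → Ω → Ω)
    (hmix : ∀ a b, mix (mix a b) (mix b a) = a) {F H : Ω → ℝ} (hF : ∀ a b, F (mix a b) = F a)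
    (hH : ∀ a b, H (mix a b) = H b) : avg (fun ω => F ω * H ω) = avg F * avg H := by
  have hcard : (Fintype.card Ω : ℝ) ≠ 0 := Nat.cast_ne_zero.2 Fintype.card_ne_zero
  let τ : Ω × Ω ≃ Ω × Ω :=
    { toFun := fun z => (mix z.1 z.2, mix z.2 z.1)
      invFun := fun z => (mix z.1 z.2, mix z.2 z.1)
      left_inv := fun z => Prod.ext (hmix _ _) (hmix _ _)
      right_inv := fun z => Prod.ext (hmix _ _) (hmix _ _) }
  have h1 : ∑ z : Ω × Ω, F z.1 * H z.1 = ∑ z : Ω × Ω, F z.1 * H z.2 := by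
    rw [← Equiv.sum_comp τ]
    refine Finset.sum_congr rfl fun z _ => ?_
    change F (mix z.1 z.2) * H (mix z.1 z.2) = _
    rw [hF, hH]
  rw [Fintype.sum_prod_type, Fintype.sum_prod_type, ← Finset.sum_mul_sum] at h1
  simp only [Finset.sum_const, Finset.card_univ, nsmul_eq_mul] at h1
  rw [← Finset.mul_sum] at h1
  rw [avg, avg, avg, div_mul_div_comm, ← h1]
  field_simp

theorem avg_mul_of_local {n : ℕ} {G : Type*} [Fintype G] [Nonempty G] (S : Finset (Fin n))
    {F H : (Fin n → G) × (Fin n → ℤˣ) → ℝ}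
    (hF : ∀ a b, (∀ v ∈ S, a.1 v = b.1 v ∧ a.2 v = b.2 v) → F a = F b)
    (hH : ∀ a b, (∀ v, v ∉ S → a.1 v = b.1 v ∧ a.2 v = b.2 v) → H a = H b) :
    avg (fun ω => F ω * H ω) = avg F * avg H := by
  refine avg_mul_of_swap (fun a b => (S.piecewise a.1 b.1, S.piecewise a.2 b.2)) ?_ ?_ ?_
  · intro a b
    refine Prod.ext (funext fun v => ?_) (funext fun v => ?_) <;>
    · by_cases hv : v ∈ S <;> simp [hv]
  · exact fun a b => hF _ _ fun v hv => by simp [hv]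
  · exact fun a b => hH _ _ fun v hv => by simp [hv]

/-! ### Moments of the signed partition signal. -/

section SignedPartition

variable {n : ℕ} {G : Type*} [DecidableEq G]

/-- The signal on the pair `e`: the product of the signs of its endpoints if they have the same
label, and zero otherwise. -/
def signal (ω : (Fin n → G) × (Fin n → ℤˣ)) (e : VertexPair n) : ℝ :=
  if ω.1 e.1.1 = ω.1 e.1.2 then ((ω.2 e.1.1 * ω.2 e.1.2 : ℤˣ) : ℤ) else 0

theorem signal_sq (ω : (Fin n → G) × (Fin n → ℤˣ)) (e : VertexPair n) :
    signal ω e ^ 2 = if ω.1 e.1.1 = ω.1 e.1.2 then 1 else 0 := by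
  unfold signal
  split_ifs
  · rcases Int.units_eq_one_or (ω.2 e.1.1 * ω.2 e.1.2) with h | h <;> simp [h]
  · norm_num

theorem abs_signal (ω : (Fin n → G) × (Fin n → ℤˣ)) (e : VertexPair n) :
    |signal ω e| = if ω.1 e.1.1 = ω.1 e.1.2 then 1 else 0 := by
  unfold signal
  split_ifs
  · rcases Int.units_eq_one_or (ω.2 e.1.1 * ω.2 e.1.2) with h | h <;> simp [h]
  · norm_num

theorem abs_signal_le_one (ω : (Fin n → G) × (Fin n → ℤˣ)) (e : VertexPair n) :
    |signal ω e| ≤ 1 := by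
  rw [abs_signal]
  split_ifs <;> norm_num

theorem signal_congr {a b : (Fin n → G) × (Fin n → ℤˣ)} {e : VertexPair n}
    (h1 : a.1 e.1.1 = b.1 e.1.1 ∧ a.2 e.1.1 = b.2 e.1.1)
    (h2 : a.1 e.1.2 = b.1 e.1.2 ∧ a.2 e.1.2 = b.2 e.1.2) : signal a e = signal b e := by
  rw [signal, signal, h1.1, h1.2, h2.1, h2.2]

theorem prod_signal_congr_of_mem {C : Finset (VertexPair n)} {S : Finset (Fin n)}
    (hC : IsClosedUnder C S) {a b : (Fin n → G) × (Fin n → ℤˣ)}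
    (h : ∀ v ∈ S, a.1 v = b.1 v ∧ a.2 v = b.2 v) :
    ∏ e ∈ C.filter (fun e => e.1.1 ∈ S), signal a e =
      ∏ e ∈ C.filter (fun e => e.1.1 ∈ S), signal b e := by
  refine Finset.prod_congr rfl fun e he => ?_
  rw [Finset.mem_filter] at he
  exact signal_congr (h _ he.2) (h _ ((hC e he.1).1 he.2))

theorem prod_signal_congr_of_notMem {C : Finset (VertexPair n)} {S : Finset (Fin n)}
    (hC : IsClosedUnder C S) {a b : (Fin n → G) × (Fin n → ℤˣ)}
    (h : ∀ v, v ∉ S → a.1 v = b.1 v ∧ a.2 v = b.2 v) :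
    ∏ e ∈ C.filter (fun e => ¬ e.1.1 ∈ S), signal a e =
      ∏ e ∈ C.filter (fun e => ¬ e.1.1 ∈ S), signal b e := by
  refine Finset.prod_congr rfl fun e he => ?_
  rw [Finset.mem_filter] at he
  exact signal_congr (h _ he.2) (h _ fun h2 => he.2 ((hC e he.1).2 h2))

variable [Fintype G]

theorem avg_abs_prod_signal [Nonempty G] (C : Finset (VertexPair n)) :
    avg (fun ω : (Fin n → G) × (Fin n → ℤˣ) => |∏ e ∈ C, signal ω e|) = agreeProb G C := by
  let F : (Fin n → G) → ℝ := fun c => if c ∈ agreeing G C then 1 else 0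
  have h1 : ∀ ω : (Fin n → G) × (Fin n → ℤˣ), |∏ e ∈ C, signal ω e| = F ω.1 := by
    intro ω
    rw [Finset.abs_prod]
    simp only [abs_signal, F, mem_agreeing]
    split_ifs with h
    · exact Finset.prod_eq_one fun e he => if_pos (h e he)
    · push Not at h
      obtain ⟨e, he, hne⟩ := h
      exact Finset.prod_eq_zero he (if_neg hne)
  simp only [h1]
  rw [avg, agreeProb, Fintype.sum_prod_type]
  simp only [Finset.sum_const, Fintype.card_prod, Fintype.card_fun, Fintype.card_fin,
    Finset.card_univ, nsmul_eq_mul]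
  rw [← Finset.mul_sum, Finset.sum_boole, Finset.filter_mem_eq_inter, Finset.univ_inter]
  have h2 : (0 : ℝ) < Fintype.card ℤˣ := Nat.cast_pos.2 Fintype.card_pos
  have h3 : (0 : ℝ) < Fintype.card G := Nat.cast_pos.2 Fintype.card_pos
  push_cast
  field_simp

theorem abs_moment_signal_le [Nonempty G] (C : Finset (VertexPair n)) :
    |moment (signal (n := n) (G := G)) C| ≤ agreeProb G C := by
  rw [← avg_abs_prod_signal]
  exact abs_avg_le _

theorem abs_targetMoment_signal_le [Nonempty G] (p : VertexPair n) (C : Finset (VertexPair n)) :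
    |targetMoment signal (fun ω : (Fin n → G) × (Fin n → ℤˣ) => signal ω p) C| ≤
      agreeProb G C := by
  rw [← avg_abs_prod_signal]
  refine (abs_avg_le _).trans (avg_mono fun ω => ?_)
  rw [abs_mul]
  exact mul_le_of_le_one_left (abs_nonneg _) (abs_signal_le_one ω p)

/-- Flipping all signs in `S` preserves the uniform law and the signal on `C`, but negates the
signal on `p`. This is the purpose of the signs in the prior. -/
theorem targetMoment_signal_eq_zero {p : VertexPair n} {C : Finset (VertexPair n)}
    {S : Finset (Fin n)} (hC : IsClosedUnder C S) (h1 : p.1.1 ∈ S) (h2 : p.1.2 ∉ S) :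
    targetMoment signal (fun ω : (Fin n → G) × (Fin n → ℤˣ) => signal ω p) C = 0 := by
  let σ : Fin n → ℤˣ := fun v => if v ∈ S then -1 else 1
  let τ : (Fin n → G) × (Fin n → ℤˣ) ≃ (Fin n → G) × (Fin n → ℤˣ) :=
    Equiv.prodCongr (Equiv.refl _) (Equiv.mulRight σ)
  have hτp : ∀ ω, signal (τ ω) p = -signal ω p := by
    intro ω
    simp only [signal, τ, σ, Equiv.prodCongr_apply, Prod.map, Equiv.refl_apply,
      Equiv.coe_mulRight, Pi.mul_apply, h1, h2, if_true, if_false]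
    split_ifs <;> simp
  have hτe : ∀ ω, ∀ e ∈ C, signal (τ ω) e = signal ω e := by
    intro ω e he
    by_cases h : e.1.1 ∈ S
    · have h' := (hC e he).1 h
      simp [signal, τ, σ, h, h']
    · have h' : e.1.2 ∉ S := fun h3 => h ((hC e he).2 h3)
      simp [signal, τ, σ, h, h']
  have h3 : ∑ ω : (Fin n → G) × (Fin n → ℤˣ), signal ω p * ∏ e ∈ C, signal ω e =
      -∑ ω : (Fin n → G) × (Fin n → ℤˣ), signal ω p * ∏ e ∈ C, signal ω e := by
    rw [← Finset.sum_neg_distrib, ← Equiv.sum_comp τ]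
    refine Finset.sum_congr rfl fun ω _ => ?_
    rw [hτp, Finset.prod_congr rfl (hτe ω)]
    ring
  rw [targetMoment, avg, div_eq_zero_iff]
  left
  linarith

theorem moment_signal_split [Nonempty G] {C : Finset (VertexPair n)} {S : Finset (Fin n)}
    (hC : IsClosedUnder C S) :
    moment (signal (G := G)) C = moment (signal (G := G)) (C.filter fun e => e.1.1 ∈ S) *
      moment (signal (G := G)) (C.filter fun e => ¬ e.1.1 ∈ S) := by
  rw [moment, moment, moment, ← avg_mul_of_local S]
  · simp only [Finset.prod_filter_mul_prod_filter_not]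
  · exact fun a b h => prod_signal_congr_of_mem hC h
  · exact fun a b h => prod_signal_congr_of_notMem hC h

theorem targetMoment_signal_split [Nonempty G] {p : VertexPair n} {C : Finset (VertexPair n)}
    {S : Finset (Fin n)} (hC : IsClosedUnder C S) (h1 : p.1.1 ∈ S) (h2 : p.1.2 ∈ S) :
    targetMoment signal (fun ω : (Fin n → G) × (Fin n → ℤˣ) => signal ω p) C =
      targetMoment signal (fun ω : (Fin n → G) × (Fin n → ℤˣ) => signal ω p)
        (C.filter fun e => e.1.1 ∈ S) *
      moment (signal (G := G)) (C.filter fun e => ¬ e.1.1 ∈ S) := by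
  rw [targetMoment, targetMoment, moment, ← avg_mul_of_local S]
  · simp only [mul_assoc, Finset.prod_filter_mul_prod_filter_not]
  · exact fun a b h => by
      rw [prod_signal_congr_of_mem hC h, signal_congr (h _ h1) (h _ h2)]
  · exact fun a b h => prod_signal_congr_of_notMem hC h

/-- A set `S` witnessing failure of anchoring either separates the endpoints of `p`, so the targets
vanish by sign flipping, or contains both and leaves an edge outside, which splits off by
independence. -/
theorem dualCoeff_signal_eq_zero [Nonempty G] {p : VertexPair n} {C : Finset (VertexPair n)}
    (hC : ¬ Anchored p C) :
    dualCoeff (moment (signal (G := G)))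
      (targetMoment signal fun ω : (Fin n → G) × (Fin n → ℤˣ) => signal ω p) C = 0 := by
  unfold Anchored at hC
  push Not at hC
  obtain ⟨S, h1, hS, h⟩ := hC
  have hmono : ∀ α C : Finset (VertexPair n), α ⊆ C → IsClosedUnder C S → IsClosedUnder α S :=
    fun α C hα hC e he => hC e (hα he)
  by_cases h2 : p.1.2 ∈ S
  · exact dualCoeff_eq_zero_of_split (by simp [moment, avg_const]) (fun C => IsClosedUnder C S)
      hmono (fun e => e.1.1 ∈ S) (fun C hC => moment_signal_split hC)
      (fun C hC => targetMoment_signal_split hC h1 h2) C hS (h h2)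
  · exact dualCoeff_eq_zero_of_target (fun C => IsClosedUnder C S) hmono
      (fun C hC => targetMoment_signal_eq_zero hC h1 h2) C hS

theorem abs_dualCoeff_signal_le [AddCommGroup G] (p : VertexPair n) {D : ℕ}
    (C : Finset (VertexPair n)) (hC : C.card ≤ D) :
    |dualCoeff (moment (signal (G := G)))
      (targetMoment signal fun ω : (Fin n → G) × (Fin n → ℤˣ) => signal ω p) C| ≤
      (4 * (D : ℝ)) ^ C.card * agreeProb G C :=
  abs_dualCoeff_le agreeProb_nonneg abs_moment_signal_le (abs_targetMoment_signal_le p)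
    (fun α C hα => by
      have h := agreeProb_mul_le (G := G) α (C \ α)
      rwa [Finset.union_sdiff_of_subset hα] at h) C hC

theorem one_div_card_le_avg_signal_sq [Nonempty G] (p : VertexPair n) :
    1 / (Fintype.card G : ℝ) ≤
      avg (fun ω : (Fin n → G) × (Fin n → ℤˣ) => signal ω p ^ 2) := by
  have h1 := avg_abs_prod_signal (G := G) {p}
  simp only [Finset.prod_singleton, abs_signal] at h1
  simp only [signal_sq]
  have hG : (0 : ℝ) < Fintype.card G := Nat.cast_pos.2 Fintype.card_pos
  rw [h1, agreeProb, div_le_div_iff₀ hG (by positivity), one_mul]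
  exact_mod_cast pow_card_le_card_agreeing_singleton p

end SignedPartition

/-! ### Polynomials in the adjacency matrix as low-degree functions of the edges. -/

section PolynomialEstimators

variable {n : ℕ}

theorem card_vertexPair (n : ℕ) : Fintype.card (VertexPair n) = n.choose 2 := by
  rw [Fintype.card_subtype, Finset.card_filter, Fintype.sum_prod_type_right]
  have h : ∀ j : Fin n, ∑ i : Fin n, (if i < j then 1 else 0) = (j : ℕ) := by
    intro j
    rw [← Finset.card_filter, Finset.filter_gt_eq_Iio, Fin.card_Iio]
  simp only [h]
  rw [Fin.sum_univ_eq_sum_range (fun i => i) n, Finset.sum_range_id, Nat.choose_two_right]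

theorem adjacency_of_lt {i j : Fin n} (h : i < j) (a : VertexPair n → Bool) :
    adjacency a i j = boolVal (a ⟨(i, j), h⟩) := by
  rw [adjacency, dif_pos h, boolVal]

theorem adjacency_eq_zero_or_boolVal (u : Fin n × Fin n) :
    (∀ a, adjacency a u.1 u.2 = 0) ∨ ∃ e, ∀ a, adjacency a u.1 u.2 = boolVal (a e) := by
  rcases lt_trichotomy u.1 u.2 with h | h | h
  · exact Or.inr ⟨⟨(u.1, u.2), h⟩, adjacency_of_lt h⟩
  · left
    intro a
    simp [adjacency, h]
  · refine Or.inr ⟨⟨(u.2, u.1), h⟩, fun a => ?_⟩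
    rw [adjacency, dif_neg h.not_gt, dif_pos h, boolVal]

theorem boolVal_mul_self (b : Bool) : boolVal b * boolVal b = boolVal b := by
  cases b <;> simp [boolVal]

theorem boolVal_pow (b : Bool) {m : ℕ} (hm : m ≠ 0) : boolVal b ^ m = boolVal b := by
  cases b <;> simp [boolVal, hm]

/-- Edge indicators are idempotent, symmetric entries coincide and diagonal entries vanish, so a
monomial becomes zero or square-free without gaining degree. -/
theorem prod_adjacency_pow (d : Fin n × Fin n → ℕ) (s : Finset (Fin n × Fin n)) :
    (∀ a, ∏ u ∈ s, adjacency a u.1 u.2 ^ d u = 0) ∨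
      ∃ β : Finset (VertexPair n), β.card ≤ ∑ u ∈ s, d u ∧
        ∀ a, ∏ u ∈ s, adjacency a u.1 u.2 ^ d u = ∏ e ∈ β, boolVal (a e) := by
  classical
  induction s using Finset.induction_on with
  | empty => exact Or.inr ⟨∅, by simp, by simp⟩
  | insert u s hu ih =>
    simp only [Finset.prod_insert hu, Finset.sum_insert hu]
    rcases ih with ih | ⟨β, hβ, ih⟩
    · exact Or.inl fun a => by rw [ih, mul_zero]
    · rcases Nat.eq_zero_or_pos (d u) with h0 | h0
      · refine Or.inr ⟨β, by omega, fun a => ?_⟩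
        rw [h0, pow_zero, one_mul, ih]
      · rcases adjacency_eq_zero_or_boolVal u with h | ⟨e, h⟩
        · exact Or.inl fun a => by rw [h, zero_pow h0.ne', zero_mul]
        · refine Or.inr ⟨insert e β, (Finset.card_insert_le _ _).trans (by omega), fun a => ?_⟩
          rw [h, boolVal_pow _ h0.ne', ih]
          by_cases he : e ∈ β
          · rw [Finset.insert_eq_of_mem he, ← Finset.mul_prod_erase β _ he, ← mul_assoc,
              boolVal_mul_self]
          · rw [Finset.prod_insert he]

theorem prod_boolVal_mem_lowDegreeSpan {E : Type*} [DecidableEq E] (q : ℝ) {D : ℕ} {β : Finset E}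
    (hβ : β.card ≤ D) : (fun a : E → Bool => ∏ e ∈ β, boolVal (a e)) ∈ lowDegreeSpan E q D := by
  have h : (fun a : E → Bool => ∏ e ∈ β, boolVal (a e)) =
      ∑ γ ∈ β.powerset, (q ^ (β \ γ).card) • fun a : E → Bool => ∏ e ∈ γ, (boolVal (a e) - q) := by
    funext a
    have h1 := Finset.prod_add (fun e => boolVal (a e) - q) (fun _ => q) β
    simp only [sub_add_cancel, Finset.prod_const] at h1
    rw [h1, Finset.sum_apply]
    exact Finset.sum_congr rfl fun γ _ => by rw [Pi.smul_apply, smul_eq_mul, mul_comm]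
  rw [h]
  refine Submodule.sum_mem _ fun γ hγ => Submodule.smul_mem _ _ (Submodule.subset_span ⟨γ, ?_, rfl⟩)
  exact (Finset.card_le_card (Finset.mem_powerset.1 hγ)).trans hβ

theorem eval_adjacency_mem_lowDegreeSpan (q : ℝ) {D : ℕ} {P : MvPolynomial (Fin n × Fin n) ℝ}
    (hP : P.totalDegree ≤ D) :
    (fun a => MvPolynomial.eval (fun u => adjacency a u.1 u.2) P) ∈
      lowDegreeSpan (VertexPair n) q D := by
  have h : (fun a => MvPolynomial.eval (fun u => adjacency a u.1 u.2) P) =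
      ∑ d ∈ P.support, P.coeff d • fun a => ∏ u ∈ d.support, adjacency a u.1 u.2 ^ d u := by
    funext a
    rw [MvPolynomial.eval_eq, Finset.sum_apply]
    exact Finset.sum_congr rfl fun d _ => rfl
  rw [h]
  refine Submodule.sum_mem _ fun d hd => Submodule.smul_mem _ _ ?_
  rcases prod_adjacency_pow d d.support with h0 | ⟨β, hβ, h1⟩
  · rw [show (fun a : VertexPair n → Bool => ∏ u ∈ d.support, adjacency a u.1 u.2 ^ d u) = 0 from
      funext h0]
    exact Submodule.zero_mem _
  · rw [funext h1]
    exact prod_boolVal_mem_lowDegreeSpan q (hβ.trans ((MvPolynomial.le_totalDegree hd).trans hP))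

theorem const_mem_lowDegreeSpan {E : Type*} (q r : ℝ) (D : ℕ) :
    (fun _ => r) ∈ lowDegreeSpan E q D := by
  have h : (fun _ => r : (E → Bool) → ℝ) =
      r • fun a : E → Bool => ∏ e ∈ (∅ : Finset E), (boolVal (a e) - q) := by
    funext a
    simp
  rw [h]
  exact Submodule.smul_mem _ _ (Submodule.subset_span ⟨∅, by simp, rfl⟩)

theorem risk_eq_sum (P : Matrix (Fin n) (Fin n) (MvPolynomial (Fin n × Fin n) ℝ))
    (M : Matrix (Fin n) (Fin n) ℝ) :
    risk P M = (1 / (n.choose 2 : ℝ)) * ∑ e : VertexPair n,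
      bernoulliExp (fun e : VertexPair n => M e.1.1 e.1.2) fun a =>
        (MvPolynomial.eval (fun u => adjacency a u.1 u.2) (P e.1.1 e.1.2) - M e.1.1 e.1.2) ^ 2 := by
  rw [← bernoulliExp_sum, ← bernoulliExp_const_mul]
  rfl

end PolynomialEstimators

/-! ### The prior on block matrices and its Bayes risk. -/

section Prior

variable {n k K : ℕ} {ρ s : ℝ}

/-- The connection probabilities `ρ / 2 + s * signal`. -/
noncomputable def signedBlockMatrix (ρ s : ℝ) (ω : (Fin n → ZMod K) × (Fin n → ℤˣ)) :
    Matrix (Fin n) (Fin n) ℝ := fun i j =>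
  if i = j then 0
  else ρ / 2 + s * (if ω.1 i = ω.1 j then ((ω.2 i * ω.2 j : ℤˣ) : ℤ) else 0)

theorem signedBlockMatrix_apply (ω : (Fin n → ZMod K) × (Fin n → ℤˣ)) (e : VertexPair n) :
    signedBlockMatrix ρ s ω e.1.1 e.1.2 = ρ / 2 + s * signal ω e := by
  rw [signedBlockMatrix, if_neg e.2.ne, signal]
  push_cast
  rfl

theorem half_add_mul_mem_Icc (hs : 0 ≤ s) (hsρ : s ≤ ρ / 4) {y : ℝ} (hy : |y| ≤ 1) :
    ρ / 2 + s * y ∈ Set.Icc (ρ / 4) (3 * ρ / 4) := by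
  have h := abs_le.1 hy
  constructor <;> nlinarith

theorem signedBlockMatrix_mem_sparseSBM [NeZero K] (hK : 2 * K ≤ k) (hs : 0 ≤ s)
    (hsρ : s ≤ ρ / 4) (ω : (Fin n → ZMod K) × (Fin n → ℤˣ)) :
    signedBlockMatrix ρ s ω ∈ sparseSBM n k ρ := by
  have hρ : 0 ≤ ρ := by linarith
  obtain ⟨f⟩ : Nonempty (ZMod K × ℤˣ ↪ Fin k) := by
    refine Function.Embedding.nonempty_of_card_le ?_
    rw [Fintype.card_prod, ZMod.card, Fintype.card_fin, Fintype.card_units_int]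
    omega
  let h : ZMod K × ℤˣ → ZMod K × ℤˣ → ℝ := fun u v =>
    ρ / 2 + s * (if u.1 = v.1 then (((u.2 * v.2 : ℤˣ) : ℤ) : ℝ) else 0)
  have hcomm : ∀ u v, h u v = h v u := fun u v => by
    simp only [h, mul_comm u.2 v.2, eq_comm (a := u.1)]
  have hmem : ∀ u v, h u v ∈ Set.Icc 0 ρ := by
    intro u v
    have h1 : |(if u.1 = v.1 then (((u.2 * v.2 : ℤˣ) : ℤ) : ℝ) else 0)| ≤ 1 := by
      split_ifs
      · rcases Int.units_eq_one_or (u.2 * v.2) with h | h <;> simp [h]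
      · norm_num
    exact Set.Icc_subset_Icc (by linarith) (by linarith) (half_add_mul_mem_Icc hs hsρ h1)
  have happly : ∀ i j, i ≠ j →
      signedBlockMatrix ρ s ω i j = h (ω.1 i, ω.2 i) (ω.1 j, ω.2 j) := by
    intro i j hij
    simp only [signedBlockMatrix, if_neg hij, h]
    push_cast
    rfl
  -- Block names outside the range of `f` get an arbitrary preimage, which is harmless because
  -- `hmem` and `hcomm` hold for all arguments.
  refine ⟨fun i j => ?_, fun i => if_pos rfl, fun i => f (ω.1 i, ω.2 i),
    fun a b => h (Function.invFun f a) (Function.invFun f b), ?_, fun a b => hmem _ _, ?_⟩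
  · by_cases hij : i = j
    · rw [signedBlockMatrix, if_pos hij]
      exact ⟨le_rfl, hρ⟩
    · rw [happly i j hij]
      exact hmem _ _
  · ext a b
    exact hcomm _ _
  · intro i j hij
    simp only [Function.leftInverse_invFun f.injective _]
    exact ⟨happly i j hij, by rw [happly j i hij.symm, hcomm]⟩

theorem le_avg_risk_signedBlockMatrix [NeZero K] (hKn : (K : ℝ) ^ 2 ≤ n) (hn : 2 ≤ n) {D : ℕ}
    (hD : 1 ≤ D) (hρ0 : 0 < ρ) (hρ1 : ρ < 1) (hs : 0 ≤ s) (hsρ : s ≤ ρ / 4) {t : ℝ} (ht0 : 0 ≤ t)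
    (ht : t ≤ 1 / 512) (hst : s ^ 2 * (16 / ρ) = t * ((K : ℝ) ^ 2 / n) / (D : ℝ) ^ 4)
    {P : Matrix (Fin n) (Fin n) (MvPolynomial (Fin n × Fin n) ℝ)}
    (hP : P ∈ lowDegreeEstimators n D) :
    s ^ 2 / (2 * K) ≤
      avg fun ω : (Fin n → ZMod K) × (Fin n → ℤˣ) => risk P (signedBlockMatrix ρ s ω) := by
  have hK1 : (1 : ℝ) ≤ K := by exact_mod_cast NeZero.one_le
  have hKn' : (K : ℝ) ≤ n := by nlinarith
  have hp : ∀ (ω : (Fin n → ZMod K) × (Fin n → ℤˣ)) (e : VertexPair n),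
      ρ / 2 + s * signal ω e ∈ Set.Icc (ρ / 4) (3 * ρ / 4) := fun ω e =>
    half_add_mul_mem_Icc hs hsρ (abs_signal_le_one ω e)
  have hp' : ∀ (ω : (Fin n → ZMod K) × (Fin n → ℤˣ)) (e : VertexPair n),
      ρ / 2 + s * signal ω e ∈ Set.Ioo 0 1 := fun ω e =>
    ⟨by linarith [(hp ω e).1], by linarith [(hp ω e).2]⟩
  have hr : ∀ (ω : (Fin n → ZMod K) × (Fin n → ℤˣ)) (e : VertexPair n),
      1 / ((ρ / 2 + s * signal ω e) * (1 - (ρ / 2 + s * signal ω e))) ≤ 16 / ρ := by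
    intro ω e
    obtain ⟨h1, h2⟩ := hp ω e
    -- The variance bound behind `16 / ρ`: the probability is at least `ρ / 4` and, since `ρ < 1`,
    -- at most `3 / 4`.
    have h3 : ρ / 4 * (1 / 4) ≤ (ρ / 2 + s * signal ω e) * (1 - (ρ / 2 + s * signal ω e)) :=
      mul_le_mul h1 (by linarith) (by norm_num) (by linarith)
    rw [div_le_div_iff₀ (by linarith [mul_pos (hp' ω e).1 (sub_pos.2 (hp' ω e).2)]) hρ0]
    linarith
  have hentry : ∀ e : VertexPair n, s ^ 2 / (2 * K) ≤
      jointExp (fun ω e => ρ / 2 + s * signal (G := ZMod K) ω e) (fun ω a =>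
        (MvPolynomial.eval (fun u => adjacency a u.1 u.2) (P e.1.1 e.1.2) - ρ / 2
          - s * signal ω e) ^ 2) := by
    intro e
    have hg := Submodule.sub_mem _
      (eval_adjacency_mem_lowDegreeSpan (ρ / 2) (hP e.1.1 e.1.2))
      (const_mem_lowDegreeSpan (E := VertexPair n) (ρ / 2) (ρ / 2) D)
    refine le_trans ?_ (le_jointExp_sub_sq (x := fun ω => signal ω e) hp' hr hg)
    have h1 := one_div_card_le_avg_signal_sq (G := ZMod K) e
    have h2 := sum_sq_mul_pow_le (p := e) (G := ZMod K) (by rwa [ZMod.card]) hD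
      (abs_dualCoeff_signal_le e) (fun C hC => dualCoeff_signal_eq_zero hC) ht0 ht
    rw [ZMod.card] at h1 h2
    rw [← hst] at h2
    have h3 : 1 / (2 * (n : ℝ)) ≤ 1 / (2 * K) := by
      gcongr
    have h4 : 1 / (K : ℝ) = 2 * (1 / (2 * K)) := by
      field_simp
    rw [div_eq_mul_one_div]
    refine mul_le_mul_of_nonneg_left ?_ (sq_nonneg s)
    linarith
  have hchoose : (0 : ℝ) < n.choose 2 := Nat.cast_pos.2 (Nat.choose_pos hn)
  simp only [risk_eq_sum, signedBlockMatrix_apply]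
  rw [avg_const_mul, avg_sum]
  calc s ^ 2 / (2 * K) = 1 / (n.choose 2 : ℝ) * ∑ _e : VertexPair n, s ^ 2 / (2 * K) := by
        rw [Finset.sum_const, Finset.card_univ, card_vertexPair, nsmul_eq_mul, ← mul_assoc,
          one_div_mul_cancel hchoose.ne', one_mul]
    _ ≤ _ := by
        refine mul_le_mul_of_nonneg_left (Finset.sum_le_sum fun e _ => ?_) (by positivity)
        refine (hentry e).trans (le_of_eq ?_)
        rw [jointExp_apply]
        simp only [sub_sub]

end Prior

/-! ### Choice of parameters and conclusion. -/

theorem theorem5 (c : ℝ) (hc0 : 0 < c) (hc1 : c < 1) :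
    ∃ c' : ℝ, 0 < c' ∧
      ∀ (n k D : ℕ) (ρ : ℝ), 2 ≤ k → (k : ℝ) ≤ Real.sqrt (n : ℝ) →
        0 < ρ → ρ < 1 → c * (k : ℝ) ^ 2 / (n : ℝ) ≤ ρ → 1 ≤ D →
        ((c' * ρ * (k : ℝ) / ((n : ℝ) * (D : ℝ) ^ 4) : ℝ) : EReal) ≤
          ⨅ P ∈ lowDegreeEstimators n D, ⨆ M ∈ sparseSBM n k ρ, ((risk P M : ℝ) : EReal) := by
  -- `49152 = 8192 * 2 * 3`: the scale of `v`, the half lost to the certificate, and `k ≤ 3 * K`.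
  refine ⟨c / 49152, by positivity, ?_⟩
  intro n k D ρ hk hkn hρ0 hρ1 hρ hD
  have hk2 : (2 : ℝ) ≤ k := by exact_mod_cast hk
  have hkn2 : (k : ℝ) ^ 2 ≤ n := (Real.le_sqrt' (by linarith)).1 hkn
  have hn4 : (4 : ℝ) ≤ n := by nlinarith
  have hn0 : (0 : ℝ) < n := by linarith
  have hn : 2 ≤ n := by
    have : 4 ≤ n := by exact_mod_cast hn4
    omega
  have hD1 : (1 : ℝ) ≤ D := by exact_mod_cast hD
  have hD4 : (1 : ℝ) ≤ (D : ℝ) ^ 4 := one_le_pow₀ hD1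
  obtain ⟨K, hK1, hKk, hkK⟩ : ∃ K : ℕ, 1 ≤ K ∧ 2 * K ≤ k ∧ k ≤ 3 * K :=
    ⟨k / 2, by omega, by omega, by omega⟩
  have : NeZero K := ⟨by omega⟩
  have hK1' : (1 : ℝ) ≤ K := by exact_mod_cast hK1
  have hKk' : (K : ℝ) ≤ k := by exact_mod_cast (by omega : K ≤ k)
  have hkK' : (k : ℝ) ≤ 3 * K := by exact_mod_cast hkK
  have hKk2 : (K : ℝ) ^ 2 ≤ (k : ℝ) ^ 2 := by gcongr
  -- The square of the signal strength `s`, chosen so that `s ^ 2 * (16 / ρ)` has the scaling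
  -- required with `t = c / 512`; `8192 = 16 * 512`.
  set v : ℝ := c / 8192 * (K : ℝ) ^ 2 * ρ / (n * (D : ℝ) ^ 4) with hv
  have hv0 : 0 ≤ v := by positivity
  have hvs : Real.sqrt v ^ 2 = v := Real.sq_sqrt hv0
  have hvρ : v ≤ (ρ / 4) ^ 2 := by
    have h1 : c * (K : ℝ) ^ 2 ≤ ρ * n := by
      rw [div_le_iff₀ hn0] at hρ
      nlinarith
    rw [hv, div_le_iff₀ (by positivity)]
    calc c / 8192 * (K : ℝ) ^ 2 * ρ = (c * (K : ℝ) ^ 2) * (ρ / 8192) := by ring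
      _ ≤ (ρ * n) * (ρ / 8192) := by gcongr
      _ = ρ ^ 2 * (1 / 8192) * (n * 1) := by ring
      _ ≤ ρ ^ 2 * (1 / 16) * (n * (D : ℝ) ^ 4) := by
        gcongr
        norm_num
      _ = (ρ / 4) ^ 2 * (n * (D : ℝ) ^ 4) := by ring
  have hsρ : Real.sqrt v ≤ ρ / 4 := Real.sqrt_le_iff.2 ⟨by linarith, hvρ⟩
  refine le_iInf₂ fun P hP => ?_
  have havg := le_avg_risk_signedBlockMatrix (K := K) (s := Real.sqrt v) (t := c / 512)
    (hKk2.trans hkn2) hn hD hρ0 hρ1 (Real.sqrt_nonneg v) hsρ (by positivity) (by linarith)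
    (by rw [hvs, hv]; field_simp; ring) hP
  obtain ⟨ω, hω⟩ := exists_avg_le fun ω : (Fin n → ZMod K) × (Fin n → ℤˣ) =>
    risk P (signedBlockMatrix ρ (Real.sqrt v) ω)
  refine le_iSup₂_of_le (signedBlockMatrix ρ (Real.sqrt v) ω)
    (signedBlockMatrix_mem_sparseSBM hKk (Real.sqrt_nonneg v) hsρ ω) ?_
  rw [EReal.coe_le_coe_iff]
  refine le_trans ?_ (havg.trans hω)
  rw [hvs]
  calc c / 49152 * ρ * k / (n * (D : ℝ) ^ 4)
      ≤ c / 49152 * ρ * (3 * K) / (n * (D : ℝ) ^ 4) := by gcongr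
    _ = v / (2 * K) := by
      rw [hv]
      field_simp
      norm_num
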